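/- Let $\mathbb D\subset\mathbb C$ be the open unit disc and let $n\ge 1$. Let $\pi_n=(\pi_{n,1},\dots,\pi_{n,n}):\mathbb C^n\to\mathbb C^n$, $\pi_{n,k}(\lambda_1,\dots,\lambda_n)=\sum_{1\le j_1<\dots<j_k\le n}\lambda_{j_1}\cdots\lambda_{j_k}$, be the symmetrization map, let $\mathbb G_n=\pi_n(\mathbb D^n)$ be the symmetrized $n$-disc, and let $\mathcal J_n=\{\lambda\in\mathbb C^n:\lambda_j=\lambda_k\text{ for some }j\ne k\}$. Then the Bergman kernel $K_{\mathbb G_n}$ of $\mathbb G_n$ exists (that is, the reproducing kernel, with respect to Lebesgue measure, of the space of square-integrable holomorphic functions $f$ on $\mathbb G_n$: $K_{\mathbb G_n}(\cdot,w)$ belongs to this space and $f(w)=\int_{\mathbb G_n}f(z)\overline{K_{\mathbb G_n}(z,w)}\,dV(z)$ for all $w\in\mathbb G_n$ and all such $f$), and for all $\lambda,\mu\in\mathbb D^n\setminus\mathcal J_n$ the Jacobian determinants $\det\pi_n'(\lambda)$ and $\det\pi_n'(\mu)$ are nonzero and $$K_{\mathbb G_n}(\pi_n(\lambda),\pi_n(\mu))=\frac{\det\left[\frac{1}{(1-\lambda_j\bar\mu_k)^2}\right]_{1\le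 j,k\le n}}{\pi^n\,\det\pi_n'(\lambda)\,\overline{\det\pi_n'(\mu)}}.$$ -/

import Mathlib

open MeasureTheory

namespace SymmetrizedPolydisc

/-- The Bergman space of a domain `D ⊆ ℂⁿ`: the functions that are holomorphic on `D` and square
integrable on `D` with respect to Lebesgue measure. (The elements are total functions on `ℂⁿ`, of
which only the restriction to `D` matters.) -/
def bergmanSpace {n : ℕ} (D : Set (Fin n → ℂ)) : Set ((Fin n → ℂ) → ℂ) :=
  {f | DifferentiableOn ℂ f D ∧ MemLp f 2 (volume.restrict D)}

/-- `K` is the reproducing kernel of the Bergman space of `D`, i.e. `K(·, w)` lies in the Bergman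
space for every `w ∈ D`, and `f(w) = ∫_D f(z) conj (K(z, w)) dV(z)` for all `f` in it. -/
structure IsBergmanKernel {n : ℕ} (D : Set (Fin n → ℂ))
    (K : (Fin n → ℂ) → (Fin n → ℂ) → ℂ) : Prop where
  mem : ∀ w ∈ D, (fun z => K z w) ∈ bergmanSpace D
  reproducing : ∀ f ∈ bergmanSpace D, ∀ w ∈ D,
    f w = ∫ z in D, f z * starRingEnd ℂ (K z w)

/-- Any two reproducing kernels satisfy `K₂(w, u) = conj (K₁(u, w))` on `D × D`. -/
theorem IsBergmanKernel.eq_conj {n : ℕ} {D : Set (Fin n → ℂ)}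
    {K₁ K₂ : (Fin n → ℂ) → (Fin n → ℂ) → ℂ} (h₁ : IsBergmanKernel D K₁)
    (h₂ : IsBergmanKernel D K₂) {u w : Fin n → ℂ} (hu : u ∈ D) (hw : w ∈ D) :
    K₂ w u = starRingEnd ℂ (K₁ u w) := by
  have e₁ := h₁.reproducing _ (h₂.mem u hu) w hw
  have e₂ := h₂.reproducing _ (h₁.mem w hw) u hu
  rw [e₁, e₂, ← integral_conj]
  refine integral_congr_ae (Filter.Eventually.of_forall fun z => ?_)
  simp [mul_comm]

/-- The reproducing kernel is unique on `D × D`. -/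
theorem IsBergmanKernel.unique {n : ℕ} {D : Set (Fin n → ℂ)}
    {K₁ K₂ : (Fin n → ℂ) → (Fin n → ℂ) → ℂ} (h₁ : IsBergmanKernel D K₁)
    (h₂ : IsBergmanKernel D K₂) {z w : Fin n → ℂ} (hz : z ∈ D) (hw : w ∈ D) :
    K₁ z w = K₂ z w := by
  rw [h₁.eq_conj h₁ hw hz, h₁.eq_conj h₂ hw hz]

open Classical in
/-- The Bergman kernel `K_D` of `D`: the reproducing kernel of the Bergman space (and `0` if there
is none); its values on `D × D` are determined by `IsBergmanKernel.unique`. -/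
noncomputable def bergmanKernel {n : ℕ} (D : Set (Fin n → ℂ)) :
    (Fin n → ℂ) → (Fin n → ℂ) → ℂ :=
  if h : ∃ K, IsBergmanKernel D K then h.choose else 0

/-- The symmetrization map `π_n : ℂⁿ → ℂⁿ`. The coordinate with index `k : Fin n` is the elementary
symmetric polynomial of degree `k + 1`. -/
def symmetrization (n : ℕ) (x : Fin n → ℂ) : Fin n → ℂ :=
  fun k => ∑ s ∈ Finset.powersetCard ((k : ℕ) + 1) (Finset.univ : Finset (Fin n)), ∏ j ∈ s, x j

/-- The open unit polydisc `𝔻ⁿ`. -/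
def polydisc (n : ℕ) : Set (Fin n → ℂ) :=
  {x | ∀ j, ‖x j‖ < 1}

/-- The symmetrized polydisc `𝔾_n = π_n(𝔻ⁿ)`. -/
def symmetrizedPolydisc (n : ℕ) : Set (Fin n → ℂ) :=
  symmetrization n '' polydisc n

/-- The set `𝒥_n` of the points of `ℂⁿ` that have two equal coordinates. -/
def coincidenceSet (n : ℕ) : Set (Fin n → ℂ) :=
  {x | ∃ j k, j ≠ k ∧ x j = x k}

/-- The complex Jacobian determinant `det π_n'(x)`. -/
noncomputable def jacobianDet (n : ℕ) (x : Fin n → ℂ) : ℂ :=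
  (fderiv ℂ (symmetrization n) x).det

end SymmetrizedPolydisc

open SymmetrizedPolydisc

/-! Write V for the Vandermonde determinant. Up to a sign depending only on n, the Jacobian
determinant of π_n is V (`exists_jacobianDet_eq`), and off a null set π_n is n!-to-one on 𝔻ⁿ. Hence
n! times an integral over 𝔾_n is an integral over 𝔻ⁿ with density |V|² (`map_withDensity_polydisc`),
and f ↦ (f ∘ π_n)·V turns square-integrable holomorphic functions on 𝔾_n into antisymmetric ones on
𝔻ⁿ. Antisymmetrizing the product kernel of 𝔻ⁿ gives, by the Leibniz formula, the determinant of the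
(1 - x_j ȳ_k)⁻²; dividing it by πⁿ V(x) conj V(y) must give the kernel of 𝔾_n.

The quotient has to be a function of π_n(x) and π_n(y) that stays holomorphic in the first variable
where V vanishes. Companion matrices achieve this: their entries are polynomial in the
symmetrizations, and the Vandermonde columns are their eigenvectors. Inverting the square of 1 - C ⊗
C' therefore expands (1 - x_j y_k)⁻² in monomials x_j^a y_k^b with a, b < n, which factors the
matrix as V(x)-matrix · coefficients · V(y)-matrix transposed (`vandermonde_mul_coeffMatrix`). The
determinant of the coefficients is the kernel.

The projection formula on 𝔻ⁿ (`polydisc_reproducing`) comes from Cauchy's formula on circles,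
Fubini, and dilation to remove boundedness. It yields the reproducing property where V(y) ≠ 0;
continuity and density give the remaining points. -/

namespace SymmetrizedPolydisc

/-! ### The symmetrization map and its Jacobian determinant. -/

open Matrix

/-- Expansion of the monic polynomial with roots `x` in terms of the symmetrization of `x`. -/
theorem prod_sub_eq_symmetrization {n : ℕ} (x : Fin n → ℂ) (t : ℂ) :
    ∏ i, (t - x i) =
      t ^ n + ∑ k : Fin n, (-1) ^ ((k : ℕ) + 1) * t ^ (n - 1 - (k : ℕ)) * symmetrization n x k := by
  rw [Finset.prod_sub, Finset.sum_powerset, Finset.card_univ, Fintype.card_fin,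
    Finset.sum_range_succ', add_comm]
  congr 1
  · simp
  · rw [Finset.sum_range]
    refine Finset.sum_congr rfl fun k _ => ?_
    rw [symmetrization, Finset.mul_sum]
    refine Finset.sum_congr rfl fun s hs => ?_
    have hc := (Finset.mem_powersetCard.1 hs).2
    rw [Finset.prod_const, Finset.card_sdiff_of_subset (Finset.subset_univ s), hc,
      Finset.card_univ, Fintype.card_fin, Nat.sub_sub, add_comm 1]

theorem symmetrization_perm {n : ℕ} (x : Fin n → ℂ) (σ : Equiv.Perm (Fin n)) :
    symmetrization n (x ∘ σ) = symmetrization n x := by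
  funext k
  refine Finset.sum_bij' (fun s _ => s.map σ.toEmbedding) (fun s _ => s.map σ.symm.toEmbedding)
    ?_ ?_ ?_ ?_ ?_
  · intro s hs
    simpa [Finset.mem_powersetCard] using hs
  · intro s hs
    simpa [Finset.mem_powersetCard] using hs
  · intro s _
    simp [Finset.map_map]
  · intro s _
    simp [Finset.map_map]
  · intro s _
    simp

theorem symmetrization_conj {n : ℕ} (x : Fin n → ℂ) (k : Fin n) :
    starRingEnd ℂ (symmetrization n x k) = symmetrization n (fun i => starRingEnd ℂ (x i)) k := by
  simp [symmetrization, map_sum, map_prod]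

theorem contDiff_symmetrization (n : ℕ) : ContDiff ℂ ⊤ (symmetrization n) := by
  unfold symmetrization
  fun_prop

theorem differentiable_symmetrization (n : ℕ) : Differentiable ℂ (symmetrization n) :=
  (contDiff_symmetrization n).differentiable (by simp)

theorem continuous_symmetrization (n : ℕ) : Continuous (symmetrization n) :=
  (contDiff_symmetrization n).continuous

/-- Points with the same symmetrization have the same set of coordinates. -/
theorem range_eq_of_symmetrization_eq {n : ℕ} {x y : Fin n → ℂ}
    (h : symmetrization n x = symmetrization n y) : Set.range x = Set.range y := by
  ext t
  have hz : ∀ z : Fin n → ℂ, t ∈ Set.range z ↔ ∏ i, (t - z i) = 0 := fun z => by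
    simp only [Set.mem_range, Finset.prod_eq_zero_iff, Finset.mem_univ, true_and, sub_eq_zero]
    simp only [eq_comm]
  rw [hz, hz, prod_sub_eq_symmetrization, prod_sub_eq_symmetrization, h]

theorem not_mem_coincidenceSet {n : ℕ} {x : Fin n → ℂ} :
    x ∉ coincidenceSet n ↔ Function.Injective x := by
  simp only [coincidenceSet, Set.mem_ofPred_eq, not_exists, not_and]
  exact ⟨fun h a b hab => by_contra fun hne => h a b hne hab, fun h a b hne hab => hne (h hab)⟩

/-- The derivative of the symmetrization, multiplied by a Vandermonde type matrix, is diagonal. -/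
theorem sum_mul_fderiv_symmetrization {n : ℕ} (x v : Fin n → ℂ) (l : Fin n) :
    ∑ k : Fin n, (-1) ^ ((k : ℕ) + 1) * x l ^ (n - 1 - (k : ℕ)) *
      fderiv ℂ (symmetrization n) x v k = -(∏ i ∈ Finset.univ.erase l, (x l - x i)) * v l := by
  -- The evaluation point t = x l is frozen; both sides of the expansion of ∏ (t - y i) are
  -- differentiated in y only, at y = x.
  have h1 : HasFDerivAt (fun y : Fin n → ℂ => ∏ i, (x l - y i))
      (∑ i, (∏ j ∈ Finset.univ.erase i, (x l - x j)) •
        (-(ContinuousLinearMap.proj i : (Fin n → ℂ) →L[ℂ] ℂ))) x :=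
    HasFDerivAt.finsetProd fun i _ => (hasFDerivAt_apply i x).const_sub (x l)
  have h2 : HasFDerivAt (fun y : Fin n → ℂ => x l ^ n + ∑ k : Fin n,
      (-1) ^ ((k : ℕ) + 1) * x l ^ (n - 1 - (k : ℕ)) * symmetrization n y k)
      (∑ k : Fin n, ((-1) ^ ((k : ℕ) + 1) * x l ^ (n - 1 - (k : ℕ))) •
        (ContinuousLinearMap.proj k ∘L fderiv ℂ (symmetrization n) x)) x := by
    refine HasFDerivAt.const_add _ (HasFDerivAt.fun_sum fun k _ => ?_)
    have := (hasFDerivAt_pi'.1 ((differentiable_symmetrization n) x).hasFDerivAt k)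
    exact this.const_mul _
  have h3 : (fun y : Fin n → ℂ => ∏ i, (x l - y i)) = (fun y : Fin n → ℂ => x l ^ n + ∑ k : Fin n,
      (-1) ^ ((k : ℕ) + 1) * x l ^ (n - 1 - (k : ℕ)) * symmetrization n y k) :=
    funext fun y => prod_sub_eq_symmetrization y (x l)
  rw [h3] at h1
  have h4 := congrArg (fun L => L v) (h2.unique h1)
  simp only [_root_.sum_apply, _root_.smul_apply,
    ContinuousLinearMap.comp_apply, ContinuousLinearMap.proj_apply, smul_eq_mul,
    _root_.neg_apply] at h4
  rw [h4, Finset.sum_eq_single l]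
  · ring
  · intro i _ hi
    rw [Finset.prod_eq_zero (Finset.mem_erase.2 ⟨hi.symm, Finset.mem_univ l⟩) (sub_self _)]
    simp
  · simp

theorem sign_cast_mul_self {n : ℕ} (σ : Equiv.Perm (Fin n)) :
    ((Equiv.Perm.sign σ : ℤ) : ℂ) * ((Equiv.Perm.sign σ : ℤ) : ℂ) = 1 := by
  rcases Int.units_eq_one_or (Equiv.Perm.sign σ) with h | h <;> simp [h]

/-- The matrix is a Vandermonde matrix with its columns reversed and rescaled by signs. Only ε² = 1
and independence of x matter later, so ε is left unevaluated. -/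
theorem exists_det_reversed_vandermonde (n : ℕ) : ∃ ε : ℂ, ε * ε = 1 ∧ ∀ x : Fin n → ℂ,
    (Matrix.of fun l k : Fin n => (-1) ^ ((k : ℕ) + 1) * x l ^ (n - 1 - (k : ℕ))).det =
      ε * (vandermonde x).det := by
  refine ⟨(∏ k : Fin n, (-1) ^ ((k : ℕ) + 1)) *
    ((Equiv.Perm.sign (Fin.revPerm : Equiv.Perm (Fin n)) : ℤ) : ℂ), ?_, fun x => ?_⟩
  · rw [mul_mul_mul_comm, sign_cast_mul_self, mul_one, ← Finset.prod_mul_distrib]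
    refine Finset.prod_eq_one fun k _ => ?_
    rw [← mul_pow]
    simp
  · rw [mul_assoc, ← det_permute' Fin.revPerm (vandermonde x), ← det_mul_row]
    congr 1
    ext l k
    simp only [of_apply, submatrix_apply, id, vandermonde_apply, Fin.revPerm_apply, Fin.val_rev]
    rw [Nat.sub_sub, add_comm 1]

/-- The discriminant: each pair of indices contributes its difference twice, with opposite signs. -/
theorem exists_prod_erase_eq (n : ℕ) : ∃ ε : ℂ, ε * ε = 1 ∧ ∀ x : Fin n → ℂ,
    ∏ l, -(∏ i ∈ Finset.univ.erase l, (x l - x i)) = ε * (vandermonde x).det ^ 2 := by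
  refine ⟨(∏ l : Fin n, -1) * ∏ l : Fin n, ∏ i ∈ Finset.Ioi l, -1, ?_, fun x => ?_⟩
  · rw [mul_mul_mul_comm, ← Finset.prod_mul_distrib, ← Finset.prod_mul_distrib]
    simp only [← Finset.prod_mul_distrib]
    simp
  · have h1 : ∀ l : Fin n, ∏ i ∈ Finset.univ.erase l, (x l - x i) =
        (∏ i ∈ Finset.Iio l, (x l - x i)) * ∏ i ∈ Finset.Ioi l, (x l - x i) := fun l => by
      rw [← Finset.prod_union]
      · congr 1
        ext i
        simp [lt_or_lt_iff_ne]
      · exact Finset.disjoint_left.2 fun i hi hi' => by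
          simp only [Finset.mem_Iio, Finset.mem_Ioi] at hi hi'
          exact lt_asymm hi hi'
    have h2 : ∏ l : Fin n, ∏ i ∈ Finset.Iio l, (x l - x i) = (vandermonde x).det := by
      rw [det_vandermonde]
      exact Finset.prod_comm' (by simp)
    have h3 : ∏ l : Fin n, ∏ i ∈ Finset.Ioi l, (x l - x i) =
        (∏ l : Fin n, ∏ i ∈ Finset.Ioi l, -1) * (vandermonde x).det := by
      rw [det_vandermonde, ← Finset.prod_mul_distrib]
      refine Finset.prod_congr rfl fun l _ => ?_
      rw [← Finset.prod_mul_distrib]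
      exact Finset.prod_congr rfl fun i _ => by ring
    calc ∏ l, -(∏ i ∈ Finset.univ.erase l, (x l - x i))
        = ∏ l, (-1 * ((∏ i ∈ Finset.Iio l, (x l - x i)) * ∏ i ∈ Finset.Ioi l, (x l - x i))) :=
          Finset.prod_congr rfl fun l _ => by rw [h1, neg_one_mul]
      _ = _ := by
          rw [Finset.prod_mul_distrib, Finset.prod_mul_distrib, h2, h3]
          ring

theorem det_vandermonde_ne_zero {n : ℕ} {x : Fin n → ℂ} (hx : x ∉ coincidenceSet n) :
    (vandermonde x).det ≠ 0 :=
  det_vandermonde_ne_zero_iff.2 (not_mem_coincidenceSet.1 hx)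

/-- Up to a sign, the Jacobian determinant of the symmetrization is the Vandermonde determinant. -/
theorem exists_jacobianDet_eq (n : ℕ) : ∃ ε : ℂ, ε * ε = 1 ∧ ∀ x ∉ coincidenceSet n,
    jacobianDet n x = ε * (vandermonde x).det := by
  obtain ⟨a, ha, hA⟩ := exists_det_reversed_vandermonde n
  obtain ⟨b, hb, hB⟩ := exists_prod_erase_eq n
  refine ⟨a * b, by rw [mul_mul_mul_comm, ha, hb, one_mul], fun x hx => ?_⟩
  have hD := det_vandermonde_ne_zero hx
  have hJ : jacobianDet n x =
      (LinearMap.toMatrix' (fderiv ℂ (symmetrization n) x : (Fin n → ℂ) →ₗ[ℂ] (Fin n → ℂ))).det := by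
    rw [LinearMap.det_toMatrix']
    rfl
  have hM : (Matrix.of fun l k : Fin n => (-1) ^ ((k : ℕ) + 1) * x l ^ (n - 1 - (k : ℕ))) *
      LinearMap.toMatrix' (fderiv ℂ (symmetrization n) x : (Fin n → ℂ) →ₗ[ℂ] (Fin n → ℂ)) =
      diagonal fun l => -(∏ i ∈ Finset.univ.erase l, (x l - x i)) := by
    ext l j
    rw [mul_apply]
    simp only [of_apply, LinearMap.toMatrix'_apply, ContinuousLinearMap.coe_coe]
    rw [sum_mul_fderiv_symmetrization, diagonal_apply]
    by_cases h : l = j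
    · simp [h]
    · simp [h]
  have h := congrArg Matrix.det hM
  rw [det_mul, hA, ← hJ, det_diagonal, hB] at h
  -- Here `h` reads a·V·J = b·V², so J = a·b·V after cancelling V and using a² = 1.
  apply mul_left_cancel₀ hD
  linear_combination a * h - (vandermonde x).det * jacobianDet n x * ha

end SymmetrizedPolydisc

/-! ### The explicit kernel, through companion matrices. -/

namespace SymmetrizedPolydisc

open Matrix
open scoped Kronecker

/-- The companion matrix of the monic polynomial whose roots have symmetrization `z`. -/
noncomputable def companion {n : ℕ} (z : Fin n → ℂ) : Matrix (Fin n) (Fin n) ℂ :=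
  Matrix.of fun i j =>
    if (i : ℕ) + 1 < n then (if (j : ℕ) = i + 1 then 1 else 0) else (-1) ^ (j.rev : ℕ) * z j.rev

/-- The vector (1, x_l, …, x_l^(n-1)) is an eigenvector for x_l: the upper rows shift powers, and
the last row expresses x_l^n through lower powers because x_l is a root. -/
theorem companion_mul_vandermonde {n : ℕ} (x : Fin n → ℂ) :
    companion (symmetrization n x) * (vandermonde x)ᵀ = (vandermonde x)ᵀ * diagonal x := by
  ext i l
  rw [mul_diagonal, mul_apply]
  simp only [companion, of_apply, transpose_apply, vandermonde_apply]
  rw [← pow_succ]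
  split_ifs with h
  · rw [Finset.sum_eq_single (⟨i + 1, h⟩ : Fin n)]
    · simp
    · intro j _ hj
      rw [if_neg fun e => hj (Fin.ext e), zero_mul]
    · simp
  · have hi : (i : ℕ) + 1 = n := by omega
    rw [hi]
    have h0 := prod_sub_eq_symmetrization x (x l)
    rw [Finset.prod_eq_zero (Finset.mem_univ l) (sub_self _)] at h0
    have h1 : ∑ j : Fin n, (-1) ^ (j.rev : ℕ) * symmetrization n x j.rev * x l ^ (j : ℕ) =
        ∑ k : Fin n, (-1) ^ (k : ℕ) * symmetrization n x k * x l ^ (n - 1 - (k : ℕ)) := by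
      refine Fintype.sum_equiv Fin.revPerm _ _ fun j => ?_
      have : n - 1 - (j.rev : ℕ) = j := by rw [Fin.val_rev]; omega
      rw [Fin.revPerm_apply, this]
    rw [h1, eq_comm, ← sub_eq_zero, sub_eq_add_neg, ← Finset.sum_neg_distrib, h0]
    congr 1
    refine Finset.sum_congr rfl fun k _ => ?_
    rw [pow_succ]
    ring

/-- The matrix `1 - C ⊗ C'`, where `C` and `C'` are the companion matrices of `z` and `w`. -/
noncomputable def kernelMatrix {n : ℕ} (z w : Fin n → ℂ) :
    Matrix (Fin n × Fin n) (Fin n × Fin n) ℂ :=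
  1 - companion z ⊗ₖ companion w

theorem kernelMatrix_mul_vandermonde {n : ℕ} (x y : Fin n → ℂ) :
    kernelMatrix (symmetrization n x) (symmetrization n y) *
      ((vandermonde x)ᵀ ⊗ₖ (vandermonde y)ᵀ) = ((vandermonde x)ᵀ ⊗ₖ (vandermonde y)ᵀ) *
      diagonal fun p => 1 - x p.1 * y p.2 := by
  have : (diagonal fun p : Fin n × Fin n => 1 - x p.1 * y p.2) =
      1 - diagonal x ⊗ₖ diagonal y := by
    rw [diagonal_kronecker_diagonal, ← diagonal_one, ← diagonal_sub]
  rw [this, kernelMatrix, sub_mul, mul_sub, one_mul, mul_one, ← mul_kronecker_mul,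
    companion_mul_vandermonde, companion_mul_vandermonde, mul_kronecker_mul]

/-- A finite union of proper real subspaces. -/
theorem volume_coincidenceSet (n : ℕ) : volume (coincidenceSet n) = 0 := by
  have : coincidenceSet n = ⋃ j, ⋃ k, ⋃ _ : j ≠ k, {x : Fin n → ℂ | x j = x k} := by
    ext; simp [coincidenceSet]
  rw [this]
  refine measure_iUnion_null fun j => measure_iUnion_null fun k => measure_iUnion_null fun h => ?_
  let S : Submodule ℝ (Fin n → ℂ) := LinearMap.ker
    ((LinearMap.proj j : (Fin n → ℂ) →ₗ[ℝ] ℂ) - LinearMap.proj k)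
  have hS : {x : Fin n → ℂ | x j = x k} = S := by
    ext x
    simp [S, LinearMap.mem_ker, sub_eq_zero]
  rw [hS]
  refine Measure.addHaar_submodule _ _ fun htop => ?_
  have : (Pi.single j 1 : Fin n → ℂ) ∈ S := by rw [htop]; trivial
  simp [S, LinearMap.mem_ker, h.symm] at this

theorem dense_compl_coincidenceSet (n : ℕ) : Dense (coincidenceSet n)ᶜ :=
  Measure.dense_of_ae (μ := volume) (measure_eq_zero_iff_ae_notMem.1 (volume_coincidenceSet n))

theorem continuous_companion (n : ℕ) : Continuous (companion : (Fin n → ℂ) → _) := by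
  refine continuous_matrix fun i j => ?_
  simp only [companion, of_apply]
  split_ifs <;> fun_prop

theorem differentiable_kernelMatrix {n : ℕ} (w : Fin n → ℂ) (p q : Fin n × Fin n) :
    Differentiable ℂ fun z => kernelMatrix z w p q := by
  simp only [kernelMatrix, Matrix.sub_apply, kroneckerMap_apply, companion, of_apply]
  split_ifs <;> fun_prop

theorem continuous_kernelMatrix {n : ℕ} {X : Type*} [TopologicalSpace X] {f g : X → Fin n → ℂ}
    (hf : Continuous f) (hg : Continuous g) : Continuous fun x => kernelMatrix (f x) (g x) := by
  have hf' := (continuous_companion n).comp hf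
  have hg' := (continuous_companion n).comp hg
  refine continuous_matrix fun i j => ?_
  simp only [kernelMatrix, Matrix.sub_apply, kroneckerMap_apply]
  exact continuous_const.sub ((hf'.matrix_elem _ _).mul (hg'.matrix_elem _ _))

/-- For distinct coordinates the Kronecker product of the Vandermonde matrices is an invertible
matrix of eigenvectors; both sides are continuous, so density gives the rest. -/
theorem det_kernelMatrix {n : ℕ} (x y : Fin n → ℂ) :
    (kernelMatrix (symmetrization n x) (symmetrization n y)).det =
      ∏ p : Fin n × Fin n, (1 - x p.1 * y p.2) := by
  have hdense := (dense_compl_coincidenceSet n).prod (dense_compl_coincidenceSet n)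
  have hs := continuous_symmetrization n
  have hc1 : Continuous fun p : (Fin n → ℂ) × (Fin n → ℂ) =>
      (kernelMatrix (symmetrization n p.1) (symmetrization n p.2)).det :=
    (continuous_kernelMatrix (hs.comp continuous_fst) (hs.comp continuous_snd)).matrix_det
  have hc2 : Continuous fun q : (Fin n → ℂ) × (Fin n → ℂ) =>
      ∏ p : Fin n × Fin n, (1 - q.1 p.1 * q.2 p.2) := by fun_prop
  refine congrFun (hc1.ext_on hdense hc2 fun q hq => ?_) (x, y)
  have h := congrArg Matrix.det (kernelMatrix_mul_vandermonde q.1 q.2)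
  rw [det_mul, det_mul, mul_comm, det_diagonal] at h
  refine mul_left_cancel₀ ?_ h
  rw [det_kronecker, det_transpose, det_transpose]
  exact mul_ne_zero (pow_ne_zero _ (det_vandermonde_ne_zero hq.1))
    (pow_ne_zero _ (det_vandermonde_ne_zero hq.2))

/-- The closed polydisc is allowed for x so that compactness later bounds the kernel uniformly in x.
-/
theorem det_kernelMatrix_ne_zero {n : ℕ} {x y : Fin n → ℂ} (hx : ∀ j, ‖x j‖ ≤ 1)
    (hy : ∀ j, ‖y j‖ < 1) :
    (kernelMatrix (symmetrization n x) (symmetrization n y)).det ≠ 0 := by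
  rw [det_kernelMatrix, Finset.prod_ne_zero_iff]
  intro p _ h
  have h1 : ‖x p.1 * y p.2‖ = 1 := by rw [← sub_eq_zero.1 h, norm_one]
  rw [norm_mul] at h1
  nlinarith [hx p.1, hy p.2, norm_nonneg (x p.1), norm_nonneg (y p.2)]

/-- The coefficients of the expansion of `(1 - x y)⁻²` in the powers of `x` and `y` below `n`, where
`x` and `y` are roots of the polynomials given by `z` and `w`. -/
noncomputable def coeffMatrix {n : ℕ} [NeZero n] (z w : Fin n → ℂ) : Matrix (Fin n) (Fin n) ℂ :=
  Matrix.of fun a b => ((kernelMatrix z w).det ^ 2)⁻¹ *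
    ((kernelMatrix z w).adjugate * (kernelMatrix z w).adjugate) (0, 0) (a, b)

theorem vandermonde_mul_coeffMatrix {n : ℕ} [NeZero n] {x y : Fin n → ℂ}
    (hx : ∀ j, ‖x j‖ ≤ 1) (hy : ∀ j, ‖y j‖ < 1) :
    vandermonde x * coeffMatrix (symmetrization n x) (symmetrization n y) * (vandermonde y)ᵀ =
      Matrix.of fun j k => 1 / (1 - x j * y k) ^ 2 := by
  set A := kernelMatrix (symmetrization n x) (symmetrization n y) with hA
  have hdet : A.det ≠ 0 := det_kernelMatrix_ne_zero hx hy
  obtain ⟨B, hB⟩ : ∃ B, B = A.adjugate * A.adjugate := ⟨_, rfl⟩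
  have hcoeff : ∀ a b, coeffMatrix (symmetrization n x) (symmetrization n y) a b =
      (A.det ^ 2)⁻¹ * B (0, 0) (a, b) := fun a b => by rw [hB]; rfl
  set W := (vandermonde x)ᵀ ⊗ₖ (vandermonde y)ᵀ with hW
  set D : Matrix (Fin n × Fin n) (Fin n × Fin n) ℂ := diagonal fun p => 1 - x p.1 * y p.2 with hD
  have hAW : A * W = W * D := kernelMatrix_mul_vandermonde x y
  have hadj : A.det • W = A.adjugate * W * D := by
    rw [Matrix.mul_assoc, ← hAW, ← Matrix.mul_assoc, adjugate_mul, Matrix.smul_mul, Matrix.one_mul]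
  -- This is A⁻² W = W D⁻² with denominators cleared; the adjugate replaces the inverse to keep
  -- entries polynomial.
  have hadj2 : A.det ^ 2 • W = B * W * (D * D) := by
    rw [hB]
    calc A.det ^ 2 • W = A.det • (A.det • W) := by rw [smul_smul, sq]
      _ = A.adjugate * (A.det • W) * D := by rw [hadj, ← Matrix.smul_mul, ← Matrix.mul_smul, hadj]
      _ = _ := by rw [hadj]; simp only [Matrix.mul_assoc]
  ext j k
  have hne : 1 - x j * y k ≠ 0 := by
    have := hdet
    rw [hA, det_kernelMatrix, Finset.prod_ne_zero_iff] at this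
    exact this (j, k) (Finset.mem_univ _)
  -- Row (0, 0) of `W` consists of ones, so this row of the identity is the expansion of (1 - x j *
  -- y k)⁻² itself. No distinctness of coordinates is needed.
  have h := congrFun (congrFun hadj2 (0, 0)) (j, k)
  rw [hD, diagonal_mul_diagonal, mul_diagonal, mul_apply, Matrix.smul_apply, hW, kroneckerMap_apply,
    Fintype.sum_prod_type] at h
  simp only [transpose_apply, vandermonde_apply, Fin.val_zero, pow_zero, mul_one,
    smul_eq_mul, kroneckerMap_apply] at h
  rw [of_apply, eq_div_iff (pow_ne_zero 2 hne), mul_apply]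
  simp only [mul_apply, vandermonde_apply, transpose_apply, hcoeff]
  rw [Finset.sum_comm' (t' := Finset.univ) (s' := fun _ => Finset.univ) (by simp)] at h
  apply mul_left_cancel₀ (pow_ne_zero 2 hdet)
  rw [mul_one]
  conv_rhs => rw [h]
  rw [← sq, ← mul_assoc, Finset.mul_sum]
  congr 1
  refine Finset.sum_congr rfl fun b _ => ?_
  rw [Finset.sum_mul, Finset.mul_sum]
  refine Finset.sum_congr rfl fun a _ => ?_
  field_simp

/-- The explicit Bergman kernel of the symmetrized polydisc. -/
noncomputable def explicitKernel (n : ℕ) [NeZero n] (z w : Fin n → ℂ) : ℂ :=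
  ((Real.pi : ℂ) ^ n)⁻¹ * (coeffMatrix z fun i => starRingEnd ℂ (w i)).det

theorem conj_symmetrization {n : ℕ} (y : Fin n → ℂ) :
    (fun i => starRingEnd ℂ (symmetrization n y i)) =
      symmetrization n fun i => starRingEnd ℂ (y i) :=
  funext fun k => symmetrization_conj y k

theorem det_vandermonde_conj {n : ℕ} (y : Fin n → ℂ) :
    (vandermonde fun i => starRingEnd ℂ (y i)).det = starRingEnd ℂ (vandermonde y).det := by
  simp [det_vandermonde, map_prod]

theorem explicitKernel_mul_vandermonde {n : ℕ} [NeZero n] {x y : Fin n → ℂ}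
    (hx : ∀ j, ‖x j‖ ≤ 1) (hy : ∀ j, ‖y j‖ < 1) :
    Real.pi ^ n * explicitKernel n (symmetrization n x) (symmetrization n y) *
      (vandermonde x).det * starRingEnd ℂ (vandermonde y).det =
      (Matrix.of fun j k => 1 / (1 - x j * starRingEnd ℂ (y k)) ^ 2).det := by
  rw [← vandermonde_mul_coeffMatrix hx (y := fun i => starRingEnd ℂ (y i))
      (fun j => by simpa using hy j),
    det_mul, det_mul, det_transpose, explicitKernel, conj_symmetrization, det_vandermonde_conj,
    mul_inv_cancel_left₀ (pow_ne_zero n (by exact_mod_cast Real.pi_ne_zero))]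
  ring

theorem continuousOn_explicitKernel (n : ℕ) [NeZero n] :
    ContinuousOn (fun p : (Fin n → ℂ) × (Fin n → ℂ) =>
      explicitKernel n (symmetrization n p.1) (symmetrization n p.2))
      ({x | ∀ j, ‖x j‖ ≤ 1} ×ˢ polydisc n) := by
  have hs := continuous_symmetrization n
  have hcj := Complex.continuous_conj
  have h1 : Continuous fun p : (Fin n → ℂ) × (Fin n → ℂ) => symmetrization n p.1 :=
    hs.comp continuous_fst
  have h2 : Continuous fun p : (Fin n → ℂ) × (Fin n → ℂ) =>
      fun i => starRingEnd ℂ (symmetrization n p.2 i) :=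
    continuous_pi fun i => hcj.comp ((continuous_apply i).comp (hs.comp continuous_snd))
  have hc : Continuous fun p : (Fin n → ℂ) × (Fin n → ℂ) => kernelMatrix (symmetrization n p.1)
      fun i => starRingEnd ℂ (symmetrization n p.2 i) :=
    continuous_kernelMatrix h1 h2
  have hdet : Continuous (Matrix.det : Matrix (Fin n) (Fin n) ℂ → ℂ) := continuous_id.matrix_det
  have hcoeff : ContinuousOn (fun p : (Fin n → ℂ) × (Fin n → ℂ) =>
      coeffMatrix (symmetrization n p.1) fun i => starRingEnd ℂ (symmetrization n p.2 i))
      ({x | ∀ j, ‖x j‖ ≤ 1} ×ˢ polydisc n) := ?_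
  · exact continuousOn_const.mul (hdet.comp_continuousOn hcoeff)
  refine continuousOn_pi.2 fun a => continuousOn_pi.2 fun b => ContinuousOn.mul ?_ ?_
  · refine ContinuousOn.inv₀ (hc.matrix_det.pow 2).continuousOn fun p hp => pow_ne_zero 2 ?_
    rw [conj_symmetrization]
    exact det_kernelMatrix_ne_zero hp.1 (fun j => by simpa using hp.2 j)
  · exact ((hc.matrix_adjugate.matrix_mul hc.matrix_adjugate).matrix_elem _ _).continuousOn

theorem differentiableAt_det {ι : Type*} [Fintype ι] [DecidableEq ι] {E : Type*}
    [NormedAddCommGroup E] [NormedSpace ℂ E] {A : E → Matrix ι ι ℂ} {z : E}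
    (hA : ∀ i j, DifferentiableAt ℂ (fun z => A z i j) z) :
    DifferentiableAt ℂ (fun z => (A z).det) z := by
  simp only [det_apply']
  fun_prop

theorem differentiableAt_adjugate {ι : Type*} [Fintype ι] [DecidableEq ι] {E : Type*}
    [NormedAddCommGroup E] [NormedSpace ℂ E] {A : E → Matrix ι ι ℂ} {z : E}
    (hA : ∀ i j, DifferentiableAt ℂ (fun z => A z i j) z) (i j : ι) :
    DifferentiableAt ℂ (fun z => (A z).adjugate i j) z := by
  simp only [adjugate_apply]
  refine differentiableAt_det fun a b => ?_
  simp only [updateRow_apply]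
  split_ifs
  · fun_prop
  · exact hA a b

theorem differentiableOn_explicitKernel {n : ℕ} [NeZero n] {w : Fin n → ℂ}
    (hw : w ∈ symmetrizedPolydisc n) :
    DifferentiableOn ℂ (fun z => explicitKernel n z w) (symmetrizedPolydisc n) := by
  obtain ⟨y, hy, rfl⟩ := hw
  rintro _ ⟨x, hx, rfl⟩
  apply DifferentiableAt.differentiableWithinAt
  unfold explicitKernel
  rw [conj_symmetrization]
  have hA : ∀ i j, DifferentiableAt ℂ (fun z => kernelMatrix z
      (symmetrization n fun i => starRingEnd ℂ (y i)) i j) (symmetrization n x) :=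
    fun i j => differentiable_kernelMatrix _ i j _
  refine (differentiableAt_det fun a b => ?_).const_mul _
  simp only [coeffMatrix, of_apply, mul_apply]
  refine DifferentiableAt.mul ?_ ?_
  · refine DifferentiableAt.inv ((differentiableAt_det hA).pow 2) (pow_ne_zero 2 ?_)
    exact det_kernelMatrix_ne_zero (fun j => (hx j).le) (fun j => by simpa using hy j)
  · exact DifferentiableAt.fun_sum fun p _ =>
      (differentiableAt_adjugate hA _ _).mul (differentiableAt_adjugate hA _ _)

end SymmetrizedPolydisc

/-! ### The Bergman projection formula on the disc. -/

namespace SymmetrizedPolydisc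

theorem integrableOn_of_continuousOn_of_bound {X : Type*} [TopologicalSpace X]
    [MeasurableSpace X] [OpensMeasurableSpace X] [SecondCountableTopology X] {μ : Measure X}
    {s : Set X} {f : X → ℂ} (hs : MeasurableSet s) (hμ : μ s < ⊤)
    (hf : ContinuousOn f s) {C : ℝ} (hC : ∀ x ∈ s, ‖f x‖ ≤ C) : IntegrableOn f s μ :=
  IntegrableOn.of_bound hμ (hf.aestronglyMeasurable hs) C
    ((ae_restrict_iff' hs).2 (Filter.Eventually.of_forall hC))

theorem one_sub_norm_le {z w : ℂ} (hz : ‖z‖ ≤ 1) :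
    1 - ‖w‖ ≤ ‖1 - starRingEnd ℂ z * w‖ := by
  have h1 := norm_sub_norm_le (1 : ℂ) (starRingEnd ℂ z * w)
  rw [norm_one, norm_mul, RCLike.norm_conj] at h1
  nlinarith [norm_nonneg w]

theorem norm_one_div_le {z w : ℂ} (hz : ‖z‖ ≤ 1) (hw : ‖w‖ < 1) :
    ‖1 / (1 - starRingEnd ℂ z * w) ^ 2‖ ≤ 1 / (1 - ‖w‖) ^ 2 := by
  rw [norm_div, norm_one, norm_pow]
  have := one_sub_norm_le (w := w) hz
  have : 0 < 1 - ‖w‖ := by linarith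
  gcongr

theorem one_sub_ne_zero {z w : ℂ} (hz : ‖z‖ ≤ 1) (hw : ‖w‖ < 1) :
    1 - starRingEnd ℂ z * w ≠ 0 := fun h => by
  have := one_sub_norm_le (w := w) hz
  rw [h, norm_zero] at this
  linarith

/-- On |z| = r one has conj z = r²/z, so the kernel equals z²/(z - r²w)². With dθ = dz/(iz) the
integral becomes Cauchy's formula for the derivative of z f(z) at r²w. -/
theorem circle_reproducing {f : ℂ → ℂ} (hf : DifferentiableOn ℂ f (Metric.ball 0 1))
    {w : ℂ} (hw : ‖w‖ < 1) {r : ℝ} (hr : r ∈ Set.Ioo (0 : ℝ) 1) :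
    ∫ θ in Set.Ioo (-Real.pi) Real.pi, f (r * Complex.exp (θ * Complex.I)) *
      (1 / (1 - starRingEnd ℂ (r * Complex.exp (θ * Complex.I)) * w) ^ 2) =
      2 * Real.pi * deriv (fun z => z * f z) (r ^ 2 * w) := by
  obtain ⟨hr0, hr1⟩ := hr
  have hw' : (r ^ 2 * w : ℂ) ∈ Metric.ball (0 : ℂ) r := by
    simp only [Metric.mem_ball, dist_zero_right, norm_mul, norm_pow, Complex.norm_real,
      Real.norm_eq_abs, abs_of_pos hr0]
    nlinarith [norm_nonneg w, mul_pos hr0 hr0]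
  have hC := Complex.two_pi_I_inv_smul_circleIntegral_sub_sq_inv_smul_of_differentiable
    (Metric.isOpen_ball (x := (0 : ℂ)) (ε := 1)) (Metric.closedBall_subset_ball hr1)
    (differentiableOn_id.mul hf) hw'
  have hper : ∀ g : ℂ → ℂ, ∫ θ in Set.Ioo (-Real.pi) Real.pi, g (circleMap 0 r θ) =
      ∫ θ in (0 : ℝ)..2 * Real.pi, g (circleMap 0 r θ) := fun g => by
    rw [← integral_Ioc_eq_integral_Ioo,
      ← intervalIntegral.integral_of_le (by linarith [Real.pi_pos])]
    have hp : Function.Periodic (fun θ => g (circleMap 0 r θ)) (2 * Real.pi) := fun θ => by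
      simp only [periodic_circleMap 0 r θ]
    have := hp.intervalIntegral_add_eq (-Real.pi) 0
    rw [zero_add] at this
    rw [← this]
    congr 1
    ring
  have hcm : ∀ θ : ℝ, (r * Complex.exp (θ * Complex.I) : ℂ) = circleMap 0 r θ := fun θ => by
    simp [circleMap]
  simp only [hcm]
  rw [hper (fun z => f z * (1 / (1 - starRingEnd ℂ z * w) ^ 2))]
  have hne : (2 * Real.pi * Complex.I : ℂ) ≠ 0 := by simp [Real.pi_ne_zero]
  rw [inv_smul_eq_iff₀ hne, circleIntegral, smul_eq_mul] at hC
  apply mul_left_cancel₀ Complex.I_ne_zero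
  have hD : deriv (fun z => z * f z) (r ^ 2 * w) = deriv (id * f) (r ^ 2 * w) := rfl
  rw [hD]
  calc _ = ∫ θ in (0 : ℝ)..2 * Real.pi, Complex.I *
        (f (circleMap 0 r θ) * (1 / (1 - starRingEnd ℂ (circleMap 0 r θ) * w) ^ 2)) := by
        rw [intervalIntegral.integral_const_mul]
    _ = _ := by
        rw [show Complex.I * (2 * Real.pi * deriv (id * f) (r ^ 2 * w)) =
          2 * Real.pi * Complex.I * deriv (id * f) (r ^ 2 * w) by ring, ← hC]
        refine intervalIntegral.integral_congr fun θ _ => ?_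
        have hz0 : circleMap 0 r θ ≠ 0 := circleMap_ne_center hr0.ne'
        have hzz : circleMap 0 r θ * starRingEnd ℂ (circleMap 0 r θ) = r ^ 2 := by
          rw [Complex.mul_conj, Complex.normSq_eq_norm_sq]
          simp
        have hsub : circleMap 0 r θ - r ^ 2 * w =
            circleMap 0 r θ * (1 - starRingEnd ℂ (circleMap 0 r θ) * w) := by
          rw [← hzz]; ring
        simp only [deriv_circleMap, Pi.mul_apply, id, smul_eq_mul, hsub]
        have hz1 : (1 - starRingEnd ℂ (circleMap 0 r θ) * w) ≠ 0 := by
          intro h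
          rw [h, mul_zero, sub_eq_zero] at hsub
          have := congrArg norm hsub
          rw [Metric.mem_ball, dist_zero_right, ← hsub] at hw'
          simp [abs_of_pos hr0] at hw'
        field_simp

/-- The integrand is the derivative of π r² f(r²w) in r. -/
theorem integral_radial_deriv {f : ℂ → ℂ} (hf : DifferentiableOn ℂ f (Metric.ball 0 1))
    {w : ℂ} (hw : ‖w‖ < 1) :
    ∫ r in Set.Ioo (0 : ℝ) 1, (r : ℂ) * (2 * Real.pi * deriv (fun z => z * f z) (r ^ 2 * w)) =
      Real.pi * f w := by
  have hmem : ∀ r ∈ Set.uIcc (0 : ℝ) 1, (r ^ 2 * w : ℂ) ∈ Metric.ball (0 : ℂ) 1 := fun r hr => by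
    rw [Set.uIcc_of_le zero_le_one] at hr
    simp only [Metric.mem_ball, dist_zero_right, norm_mul, norm_pow, Complex.norm_real,
      Real.norm_eq_abs, abs_of_nonneg hr.1]
    have : r ^ 2 ≤ 1 := pow_le_one₀ hr.1 hr.2
    nlinarith [norm_nonneg w]
  have hg : DifferentiableOn ℂ (fun z => z * f z) (Metric.ball 0 1) := differentiableOn_id.mul hf
  have hder : ∀ r ∈ Set.uIcc (0 : ℝ) 1, HasDerivAt (fun r : ℝ => Real.pi * (r ^ 2 * f (r ^ 2 * w)))
      ((r : ℂ) * (2 * Real.pi * deriv (fun z => z * f z) (r ^ 2 * w))) r := fun r hr => by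
    have hd := (hf.differentiableAt (Metric.isOpen_ball.mem_nhds (hmem r hr))).hasDerivAt
    have hd' : deriv (fun z => z * f z) (r ^ 2 * w) =
        f (r ^ 2 * w) + (r ^ 2 * w) * deriv f (r ^ 2 * w) := by
      have := ((hasDerivAt_id' (r ^ 2 * w : ℂ)).fun_mul hd).deriv
      rw [this]
      simp
    have hi : HasDerivAt (fun r : ℝ => (r : ℂ) ^ 2) (2 * r) r := by
      have := (hasDerivAt_id (r : ℂ)).pow 2
      simpa using this.comp_ofReal
    have hi' : HasDerivAt (fun r : ℝ => (r : ℂ) ^ 2 * w) (2 * r * w) r := hi.mul_const w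
    have := (hi.fun_mul (hd.comp r hi')).const_mul (Real.pi : ℂ)
    refine this.congr_deriv ?_
    rw [hd']
    simp only [Function.comp]
    ring
  have hcont : ContinuousOn (fun r : ℝ => (r : ℂ) *
      (2 * Real.pi * deriv (fun z => z * f z) (r ^ 2 * w))) (Set.uIcc 0 1) := by
    refine Complex.continuous_ofReal.continuousOn.mul (continuousOn_const.mul ?_)
    exact (hg.deriv Metric.isOpen_ball).continuousOn.comp (by fun_prop) hmem
  rw [← integral_Ioc_eq_integral_Ioo, ← intervalIntegral.integral_of_le zero_le_one,
    intervalIntegral.integral_eq_sub_of_hasDerivAt hder hcont.intervalIntegrable]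
  simp

/-- The Bergman projection formula of the unit disc, for bounded holomorphic functions. -/
theorem disc_reproducing {f : ℂ → ℂ} {M : ℝ} (hf : DifferentiableOn ℂ f (Metric.ball 0 1))
    (hM : ∀ z ∈ Metric.ball (0 : ℂ) 1, ‖f z‖ ≤ M) {w : ℂ} (hw : ‖w‖ < 1) :
    ∫ z in Metric.ball (0 : ℂ) 1, f z * (1 / (1 - starRingEnd ℂ z * w) ^ 2) = Real.pi * f w := by
  set F : ℂ → ℂ := fun z => f z * (1 / (1 - starRingEnd ℂ z * w) ^ 2) with hF
  have hM0 : 0 ≤ M := (norm_nonneg _).trans (hM 0 (by simp))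
  have hFc : ContinuousOn F (Metric.ball 0 1) := by
    refine hf.continuousOn.mul (continuousOn_const.div ?_ ?_)
    · have := Complex.continuous_conj
      fun_prop
    · intro z hz
      exact pow_ne_zero 2 (one_sub_ne_zero (mem_ball_zero_iff.1 hz).le hw)
  have hFb : ∀ z ∈ Metric.ball (0 : ℂ) 1, ‖F z‖ ≤ M * (1 / (1 - ‖w‖) ^ 2) := fun z hz => by
    rw [hF, norm_mul]
    exact mul_le_mul (hM z hz) (norm_one_div_le (mem_ball_zero_iff.1 hz).le hw) (norm_nonneg _) hM0
  have hpol : ∀ p : ℝ × ℝ, Complex.polarCoord.symm p = p.1 * Complex.exp (p.2 * Complex.I) :=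
    fun p => by rw [Complex.polarCoord_symm_apply, Complex.exp_mul_I]; push_cast; ring
  have hmem : ∀ p : ℝ × ℝ, p ∈ polarCoord.target → (Complex.polarCoord.symm p ∈
      Metric.ball (0 : ℂ) 1 ↔ p ∈ Set.Ioo (0 : ℝ) 1 ×ˢ Set.Ioo (-Real.pi) Real.pi) := fun p hp => by
    rw [polarCoord_target, Set.mem_prod] at hp
    rw [Metric.mem_ball, dist_zero_right, Complex.norm_polarCoord_symm, abs_of_pos hp.1]
    exact ⟨fun h => ⟨⟨hp.1, h⟩, hp.2⟩, fun h => h.1.2⟩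
  have hsub : Set.Ioo (0 : ℝ) 1 ×ˢ Set.Ioo (-Real.pi) Real.pi ⊆ polarCoord.target := by
    rw [polarCoord_target]
    exact Set.prod_mono Set.Ioo_subset_Ioi_self le_rfl
  have hms : MeasurableSet (Set.Ioo (0 : ℝ) 1 ×ˢ Set.Ioo (-Real.pi) Real.pi) :=
    measurableSet_Ioo.prod measurableSet_Ioo
  rw [← integral_indicator measurableSet_ball, ← Complex.integral_comp_polarCoord_symm]
  have h1 : ∫ p in polarCoord.target,
      p.1 • (Metric.ball (0 : ℂ) 1).indicator F (Complex.polarCoord.symm p) =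
      ∫ p in Set.Ioo (0 : ℝ) 1 ×ˢ Set.Ioo (-Real.pi) Real.pi,
        (p.1 : ℂ) * F (p.1 * Complex.exp (p.2 * Complex.I)) := by
    rw [← Set.inter_eq_self_of_subset_right hsub, ← setIntegral_indicator hms]
    refine setIntegral_congr_fun polarCoord.open_target.measurableSet fun p hp => ?_
    by_cases h : p ∈ Set.Ioo (0 : ℝ) 1 ×ˢ Set.Ioo (-Real.pi) Real.pi
    · rw [Set.indicator_of_mem h, Set.indicator_of_mem ((hmem p hp).2 h), hpol]
      exact Complex.real_smul
    · simp only [Set.indicator_of_notMem h, Set.indicator_of_notMem (mt (hmem p hp).1 h), smul_zero]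
  rw [h1, Measure.volume_eq_prod, setIntegral_prod]
  · rw [← integral_radial_deriv hf hw]
    refine setIntegral_congr_fun measurableSet_Ioo fun r hr => ?_
    simp only
    rw [integral_const_mul, hF, circle_reproducing hf hw hr]
  · rw [← Measure.volume_eq_prod]
    refine integrableOn_of_continuousOn_of_bound hms ?_ (C := M * (1 / (1 - ‖w‖) ^ 2)) ?_ ?_
    · rw [Measure.volume_eq_prod, Measure.prod_prod]
      simp
    · refine ContinuousOn.mul (by fun_prop) (hFc.comp (by fun_prop) fun p hp => ?_)
      rw [← hpol]
      exact (hmem p (hsub hp)).2 hp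
    · intro p hp
      rw [norm_mul, ← hpol]
      have := hFb _ ((hmem p (hsub hp)).2 hp)
      have h0 : ‖(p.1 : ℂ)‖ ≤ 1 := by
        rw [Complex.norm_real, Real.norm_eq_abs, abs_of_pos hp.1.1]
        exact hp.1.2.le
      nlinarith [norm_nonneg (F (Complex.polarCoord.symm p))]

end SymmetrizedPolydisc

/-! ### The Bergman projection formula on the polydisc. -/

namespace SymmetrizedPolydisc

open Filter Topology

theorem isOpen_polydisc (n : ℕ) : IsOpen (polydisc n) := by
  have : polydisc n = ⋂ j, {x : Fin n → ℂ | ‖x j‖ < 1} := by ext; simp [polydisc]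
  rw [this]
  exact isOpen_iInter_of_finite fun j => isOpen_lt (by fun_prop) continuous_const

theorem volume_polydisc_lt_top (n : ℕ) : volume (polydisc n) < ⊤ := by
  refine (Metric.isBounded_closedBall (x := (0 : Fin n → ℂ)) (r := 1)).subset ?_
    |>.measure_lt_top
  intro x hx
  rw [mem_closedBall_zero_iff]
  exact (pi_norm_le_iff_of_nonneg zero_le_one).2 fun i => (hx i).le

/-- The product kernel `∏ⱼ (1 - conj xⱼ yⱼ)⁻²`. -/
noncomputable def prodKernel {n : ℕ} (x y : Fin n → ℂ) : ℂ :=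
  ∏ j, 1 / (1 - starRingEnd ℂ (x j) * y j) ^ 2

theorem continuousOn_prodKernel {n : ℕ} {y : Fin n → ℂ} (hy : y ∈ polydisc n) :
    ContinuousOn (fun x => prodKernel x y) (polydisc n) := by
  have := Complex.continuous_conj
  refine continuousOn_finsetProd _ fun j _ => continuousOn_const.div (by fun_prop) fun x hx => ?_
  exact pow_ne_zero 2 (one_sub_ne_zero (hx j).le (hy j))

theorem exists_bound_prodKernel {n : ℕ} {y : Fin n → ℂ} (hy : y ∈ polydisc n) :
    ∃ C, 0 ≤ C ∧ ∀ x ∈ polydisc n, ‖prodKernel x y‖ ≤ C := by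
  refine ⟨∏ j, 1 / (1 - ‖y j‖) ^ 2, Finset.prod_nonneg fun j _ => by positivity, fun x hx => ?_⟩
  rw [prodKernel, norm_prod]
  exact Finset.prod_le_prod (fun _ _ => norm_nonneg _) fun j _ => norm_one_div_le (hx j).le (hy j)

/-- Induction by Fubini, splitting off the first coordinate. Boundedness passes to slices and makes
the integrand integrable. -/
theorem polydisc_reproducing_of_bound : ∀ {n : ℕ} {F : (Fin n → ℂ) → ℂ} {M : ℝ},
    DifferentiableOn ℂ F (polydisc n) → (∀ x ∈ polydisc n, ‖F x‖ ≤ M) → ∀ {y : Fin n → ℂ},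
    y ∈ polydisc n → ∫ x in polydisc n, F x * prodKernel x y = Real.pi ^ n * F y := by
  intro n
  induction n with
  | zero =>
    intro F M _ _ y _
    -- In dimension zero the space is one point of mass 1 and the kernel is an empty product.
    have h : polydisc 0 = Set.univ := Set.eq_univ_of_forall fun x j => j.elim0
    rw [h, setIntegral_univ, volume_pi, Measure.pi_of_empty _ y, integral_dirac]
    simp [prodKernel]
  | succ n ih =>
    intro F M hF hM y hy
    have hM0 : 0 ≤ M := (norm_nonneg _).trans (hM y hy)
    set y' : Fin n → ℂ := fun j => y j.succ with hy'
    have hym : y' ∈ polydisc n := fun j => hy j.succ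
    have he := (volume_preserving_piFinSuccAbove (fun _ : Fin (n + 1) => ℂ) 0).symm
    have hsymm : ∀ p : ℂ × (Fin n → ℂ),
        (MeasurableEquiv.piFinSuccAbove (fun _ : Fin (n + 1) => ℂ) 0).symm p =
          (Fin.cons p.1 p.2 : Fin (n + 1) → ℂ) := fun p => by
      simp [MeasurableEquiv.piFinSuccAbove, Fin.insertNthEquiv]
    have hmem : ∀ (a : ℂ) (b : Fin n → ℂ), (Fin.cons a b : Fin (n + 1) → ℂ) ∈ polydisc (n + 1) ↔
        a ∈ Metric.ball (0 : ℂ) 1 ∧ b ∈ polydisc n := fun a b => by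
      simp [polydisc, Fin.forall_fin_succ]
    have hpre : (MeasurableEquiv.piFinSuccAbove (fun _ : Fin (n + 1) => ℂ) 0).symm ⁻¹'
        polydisc (n + 1) = Metric.ball (0 : ℂ) 1 ×ˢ polydisc n := by
      ext p
      rw [Set.mem_preimage, hsymm, hmem, Set.mem_prod]
    have hcons1 : ∀ b : Fin n → ℂ, Differentiable ℂ fun a : ℂ => (Fin.cons a b : Fin (n + 1) → ℂ) :=
      fun b => differentiable_pi.2 fun j => by
        refine Fin.cases ?_ (fun j => ?_) j <;> simp
    have hcons2 : ∀ a : ℂ, Differentiable ℂ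
        fun b : Fin n → ℂ => (Fin.cons a b : Fin (n + 1) → ℂ) :=
      fun a => differentiable_pi.2 fun j => by
        refine Fin.cases ?_ (fun j => ?_) j
        · simp
        · simpa using differentiable_apply j
    have hcons : Continuous fun p : ℂ × (Fin n → ℂ) => (Fin.cons p.1 p.2 : Fin (n + 1) → ℂ) :=
      continuous_pi fun j => by
        refine Fin.cases ?_ (fun j => ?_) j
        · simpa using continuous_fst
        · simp only [Fin.cons_succ]; fun_prop
    have hker : ∀ (a : ℂ) (b : Fin n → ℂ), prodKernel (Fin.cons a b : Fin (n + 1) → ℂ) y =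
        1 / (1 - starRingEnd ℂ a * y 0) ^ 2 * prodKernel b y' := fun a b => by
      simp [prodKernel, Fin.prod_univ_succ, hy', mul_comm]
    have hint : IntegrableOn (fun p : ℂ × (Fin n → ℂ) =>
        F (Fin.cons p.1 p.2) * prodKernel (Fin.cons p.1 p.2 : Fin (n + 1) → ℂ) y)
        (Metric.ball (0 : ℂ) 1 ×ˢ polydisc n) (volume.prod volume) := by
      obtain ⟨C, hC0, hC⟩ := exists_bound_prodKernel hy
      refine integrableOn_of_continuousOn_of_bound
        (measurableSet_ball.prod (isOpen_polydisc n).measurableSet) ?_ ?_ (C := M * C) ?_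
      · rw [Measure.prod_prod]
        exact ENNReal.mul_lt_top measure_ball_lt_top (volume_polydisc_lt_top n)
      · have hmaps : Set.MapsTo (fun p : ℂ × (Fin n → ℂ) => (Fin.cons p.1 p.2 : Fin (n + 1) → ℂ))
            (Metric.ball (0 : ℂ) 1 ×ˢ polydisc n) (polydisc (n + 1)) :=
          fun p hp => (hmem _ _).2 hp
        exact (hF.continuousOn.comp hcons.continuousOn hmaps).mul
          ((continuousOn_prodKernel hy).comp hcons.continuousOn hmaps)
      · intro p hp
        rw [norm_mul]
        have := (hmem _ _).2 hp
        exact mul_le_mul (hM _ this) (hC _ this) (norm_nonneg _) hM0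
    rw [← he.setIntegral_preimage_emb (MeasurableEquiv.measurableEmbedding _), hpre]
    simp only [hsymm]
    rw [Measure.volume_eq_prod, setIntegral_prod _ hint]
    have hinner : ∀ a ∈ Metric.ball (0 : ℂ) 1, ∫ b in polydisc n,
        F (Fin.cons a b) * prodKernel (Fin.cons a b : Fin (n + 1) → ℂ) y =
        Real.pi ^ n * (F (Fin.cons a y') * (1 / (1 - starRingEnd ℂ a * y 0) ^ 2)) := fun a ha => by
      have := ih (F := fun b => F (Fin.cons a b)) (M := M)
        (hF.comp (hcons2 a).differentiableOn fun b hb => (hmem _ _).2 ⟨ha, hb⟩)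
        (fun b hb => hM _ ((hmem _ _).2 ⟨ha, hb⟩)) hym
      rw [← mul_assoc, ← this, ← integral_mul_const]
      refine integral_congr_ae (Filter.Eventually.of_forall fun b => ?_)
      simp only [hker]
      ring
    rw [setIntegral_congr_fun measurableSet_ball hinner, integral_const_mul,
      disc_reproducing (f := fun a => F (Fin.cons a y')) (M := M)
        (hF.comp (hcons1 y').differentiableOn fun a ha => (hmem _ _).2 ⟨ha, hym⟩)
        (fun a ha => hM _ ((hmem _ _).2 ⟨ha, hym⟩)) (hy 0)]
    have : (Fin.cons (y 0) y' : Fin (n + 1) → ℂ) = y := Fin.cons_self_tail y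
    rw [this]
    ring

theorem isCompact_closedPolydisc (n : ℕ) (r : ℝ) :
    IsCompact {x : Fin n → ℂ | ∀ j, ‖x j‖ ≤ r} := by
  have : {x : Fin n → ℂ | ∀ j, ‖x j‖ ≤ r} = Set.univ.pi fun _ => Metric.closedBall (0 : ℂ) r := by
    ext; simp
  rw [this]
  exact isCompact_univ_pi fun _ => isCompact_closedBall _ _

/-- The Bergman projection formula of the polydisc, for integrable holomorphic functions. -/
theorem polydisc_reproducing {n : ℕ} {F : (Fin n → ℂ) → ℂ} (hF : DifferentiableOn ℂ F (polydisc n))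
    (hi : IntegrableOn F (polydisc n)) {y : Fin n → ℂ} (hy : y ∈ polydisc n) :
    ∫ x in polydisc n, F x * prodKernel x y = Real.pi ^ n * F y := by
  have hP := (isOpen_polydisc n).measurableSet
  have hnorm : ∀ (r : ℝ) (x : Fin n → ℂ) (j : Fin n), 0 < r → ‖(r • x) j‖ = r * ‖x j‖ :=
    fun r x j hr => by
      rw [Pi.smul_apply, norm_smul, Real.norm_eq_abs, abs_of_pos hr]
  have hmaps : ∀ r : ℝ, r ∈ Set.Ioo (0 : ℝ) 1 → ∀ x ∈ polydisc n, r • x ∈ polydisc n :=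
    fun r hr x hx j => by
      rw [hnorm r x j hr.1]
      nlinarith [hx j, norm_nonneg (x j), hr.1, hr.2]
  -- The substitution u = r x moves the dilation from F, which is only integrable, to the kernel,
  -- which is bounded.
  set g : ℝ → (Fin n → ℂ) → ℂ := fun r =>
    Set.indicator {u | r⁻¹ • u ∈ polydisc n} fun u => F u * prodKernel (r⁻¹ • u) y with hg
  have hsub : ∀ r : ℝ, r ∈ Set.Ioo (0 : ℝ) 1 → {u | r⁻¹ • u ∈ polydisc n} ⊆ polydisc n :=
    fun r hr u hu => by
      have := hmaps r hr _ hu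
      rwa [smul_inv_smul₀ hr.1.ne'] at this
  have hopen : ∀ r : ℝ, IsOpen {u : Fin n → ℂ | r⁻¹ • u ∈ polydisc n} := fun r =>
    (isOpen_polydisc n).preimage (continuous_const_smul r⁻¹)
  have hscaled : ∀ r ∈ Set.Ioo (0 : ℝ) 1, Real.pi ^ n * F (r • y) =
      |(r ^ Module.finrank ℝ (Fin n → ℂ))⁻¹| • ∫ u, g r u := fun r hr => by
    have hsm : DifferentiableOn ℂ (fun x : Fin n → ℂ => r • x) (polydisc n) :=
      (differentiable_id.const_smul r).differentiableOn
    obtain ⟨M, hM⟩ := (isCompact_closedPolydisc n r).exists_bound_of_continuousOn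
      (hF.continuousOn.mono fun x hx j => (hx j).trans_lt hr.2)
    have hb := polydisc_reproducing_of_bound (F := fun x => F (r • x)) (M := M)
      (hF.comp hsm (hmaps r hr))
      (fun x hx => hM _ fun j => by
        rw [hnorm r x j hr.1]
        nlinarith [hx j, norm_nonneg (x j), hr.1]) hy
    rw [← hb, ← Measure.integral_comp_smul, ← integral_indicator hP]
    refine integral_congr_ae (Filter.Eventually.of_forall fun x => ?_)
    have hx : r⁻¹ • r • x = x := inv_smul_smul₀ hr.1.ne' x
    by_cases h : x ∈ polydisc n
    · have h' : r • x ∈ {u | r⁻¹ • u ∈ polydisc n} := by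
        rw [Set.mem_ofPred_eq, hx]; exact h
      simp only [hg]
      rw [Set.indicator_of_mem h, Set.indicator_of_mem h', hx]
    · have h' : r • x ∉ {u | r⁻¹ • u ∈ polydisc n} := by
        rw [Set.mem_ofPred_eq, hx]; exact h
      simp only [hg]
      rw [Set.indicator_of_notMem h, Set.indicator_of_notMem h']
  have hev : ∀ᶠ r : ℝ in 𝓝[<] 1, r ∈ Set.Ioo (0 : ℝ) 1 := Ioo_mem_nhdsLT zero_lt_one
  have hr1 : Tendsto (fun r : ℝ => r) (𝓝[<] 1) (𝓝 1) := nhdsWithin_le_nhds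
  have hlim1 : Tendsto (fun r : ℝ => Real.pi ^ n * F (r • y)) (𝓝[<] 1) (𝓝 (Real.pi ^ n * F y)) := by
    have hc : ContinuousAt F y := hF.continuousOn.continuousAt ((isOpen_polydisc n).mem_nhds hy)
    have h1 : Tendsto (fun r : ℝ => r • y) (𝓝[<] 1) (𝓝 y) := by
      simpa using hr1.smul_const y
    exact (hc.tendsto.comp h1).const_mul _
  have hlim2 : Tendsto (fun r : ℝ => ∫ u, g r u) (𝓝[<] 1)
      (𝓝 (∫ u, (polydisc n).indicator (fun u => F u * prodKernel u y) u)) := by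
    obtain ⟨C, hC0, hC⟩ := exists_bound_prodKernel hy
    -- `C` bounds the kernel at r⁻¹u uniformly in r, since r⁻¹u lies in the polydisc on the set to
    -- which `g r` is cut off.
    refine tendsto_integral_filter_of_dominated_convergence
      ((polydisc n).indicator fun u => ‖F u‖ * C) ?_ ?_ ?_ ?_
    · filter_upwards [hev] with r hr
      rw [hg, aestronglyMeasurable_indicator_iff (hopen r).measurableSet]
      refine ContinuousOn.aestronglyMeasurable ?_ (hopen r).measurableSet
      exact (hF.continuousOn.mono (hsub r hr)).mul
        ((continuousOn_prodKernel hy).comp (continuous_const_smul r⁻¹).continuousOn fun u hu => hu)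
    · filter_upwards [hev] with r hr
      refine Filter.Eventually.of_forall fun u => ?_
      by_cases h : u ∈ {u | r⁻¹ • u ∈ polydisc n}
      · simp only [hg]
        rw [Set.indicator_of_mem h, Set.indicator_of_mem (hsub r hr h), norm_mul]
        exact mul_le_mul_of_nonneg_left (hC _ h) (norm_nonneg _)
      · simp only [hg]
        rw [Set.indicator_of_notMem h, norm_zero]
        exact Set.indicator_nonneg (fun _ _ => by positivity) _
    · rw [integrable_indicator_iff hP]
      exact hi.norm.mul_const C
    · refine Filter.Eventually.of_forall fun u => ?_
      by_cases h : u ∈ polydisc n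
      · rw [Set.indicator_of_mem h]
        have h1 : Tendsto (fun r : ℝ => r⁻¹ • u) (𝓝[<] 1) (𝓝 u) := by
          simpa using (hr1.inv₀ one_ne_zero).smul_const u
        have hc := (continuousOn_prodKernel hy).continuousAt ((isOpen_polydisc n).mem_nhds h)
        refine ((hc.tendsto.comp h1).const_mul (F u)).congr' ?_
        filter_upwards [h1.eventually ((isOpen_polydisc n).mem_nhds h)] with r hr
        exact (Set.indicator_of_mem (s := {u : Fin n → ℂ | r⁻¹ • u ∈ polydisc n}) hr
          fun u => F u * prodKernel (r⁻¹ • u) y).symm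
      · rw [Set.indicator_of_notMem h]
        refine tendsto_const_nhds.congr' ?_
        filter_upwards [hev] with r hr
        exact (Set.indicator_of_notMem (fun h' => h (hsub r hr h')) _).symm
  have hlim3 : Tendsto (fun r : ℝ => |(r ^ Module.finrank ℝ (Fin n → ℂ))⁻¹|) (𝓝[<] 1) (𝓝 1) := by
    have h1 : (1 : ℝ) ^ Module.finrank ℝ (Fin n → ℂ) ≠ 0 := by simp
    simpa using ((hr1.pow (Module.finrank ℝ (Fin n → ℂ))).inv₀ h1).abs
  have hlim := hlim3.smul hlim2
  rw [one_smul, integral_indicator hP] at hlim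
  refine tendsto_nhds_unique (hlim.congr' ?_) hlim1
  filter_upwards [hev] with r hr
  exact (hscaled r hr).symm

end SymmetrizedPolydisc

/-! ### Change of variables under the symmetrization map. -/

namespace SymmetrizedPolydisc

open Matrix
open scoped ENNReal

/-- The points of the polydisc whose coordinates are strictly increasing in the lexicographic order
on `ℂ = ℝ × ℝ`. -/
def chamber (n : ℕ) : Set (Fin n → ℂ) :=
  {x | x ∈ polydisc n ∧ StrictMono fun i => toLex ((x i).re, (x i).im)}

theorem toLex_re_im_injective : Function.Injective fun z : ℂ => toLex (z.re, z.im) := fun a b h => by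
  have := toLex.injective h
  exact Complex.ext (congrArg Prod.fst this) (congrArg Prod.snd this)

theorem measurableSet_chamber (n : ℕ) : MeasurableSet (chamber n) := by
  have : chamber n = polydisc n ∩ ⋂ i : Fin n, ⋂ j : Fin n, ⋂ _ : i < j,
      ({x | (x i).re < (x j).re} ∪ ({x | (x i).re = (x j).re} ∩ {x | (x i).im < (x j).im})) := by
    ext x
    simp only [chamber, StrictMono, Set.mem_ofPred_eq, Prod.Lex.toLex_lt_toLex, Set.mem_inter_iff,
      Set.mem_iInter, Set.mem_union]
  rw [this]
  refine (isOpen_polydisc n).measurableSet.inter (MeasurableSet.iInter fun i =>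
    MeasurableSet.iInter fun j => MeasurableSet.iInter fun _ => ?_)
  refine (measurableSet_lt ?_ ?_).union ((measurableSet_eq_fun ?_ ?_).inter (measurableSet_lt ?_ ?_))
    <;> fun_prop

theorem chamber_subset_polydisc (n : ℕ) : chamber n ⊆ polydisc n := fun _ hx => hx.1

theorem not_mem_coincidenceSet_of_mem_chamber {n : ℕ} {x : Fin n → ℂ} (hx : x ∈ chamber n) :
    x ∉ coincidenceSet n :=
  not_mem_coincidenceSet.2 fun _ _ h => hx.2.injective (by simp only [h])

/-- The symmetrization determines the set of coordinates, and a strictly increasing enumeration is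
determined by its range. -/
theorem injOn_symmetrization_chamber (n : ℕ) : Set.InjOn (symmetrization n) (chamber n) := by
  intro x hx y hy h
  have hr := range_eq_of_symmetrization_eq h
  have hr' : (Set.range fun i => toLex ((x i).re, (x i).im)) =
      Set.range fun i => toLex ((y i).re, (y i).im) := by
    have hc : ∀ z : Fin n → ℂ, (Set.range fun i => toLex ((z i).re, (z i).im)) =
        (fun c : ℂ => toLex (c.re, c.im)) '' Set.range z := fun z =>
      Set.range_comp (fun c : ℂ => toLex (c.re, c.im)) z
    rw [hc, hc, hr]
  have := (hx.2.range_inj hy.2).1 hr'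
  exact funext fun i => toLex_re_im_injective (congrFun this i)

theorem perm_mem_polydisc {n : ℕ} {x : Fin n → ℂ} (σ : Equiv.Perm (Fin n)) :
    x ∘ σ ∈ polydisc n ↔ x ∈ polydisc n :=
  ⟨fun h j => by simpa using h (σ.symm j), fun h j => h (σ j)⟩

theorem existsUnique_perm_mem_chamber {n : ℕ} {x : Fin n → ℂ} (hx : x ∈ polydisc n)
    (hc : x ∉ coincidenceSet n) : ∃! σ : Equiv.Perm (Fin n), x ∘ σ ∈ chamber n := by
  have hinj := not_mem_coincidenceSet.1 hc
  set g : Fin n → ℝ ×ₗ ℝ := fun i => toLex ((x i).re, (x i).im) with hg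
  have hginj : Function.Injective g := fun a b h => hinj (toLex_re_im_injective h)
  refine ⟨Tuple.sort g, ⟨(perm_mem_polydisc _).2 hx, ?_⟩, fun τ hτ => ?_⟩
  · exact (Tuple.monotone_sort g).strictMono_of_injective (hginj.comp (Tuple.sort g).injective)
  · have h1 : StrictMono (g ∘ τ) := hτ.2
    have h2 : StrictMono (g ∘ Tuple.sort g) :=
      (Tuple.monotone_sort g).strictMono_of_injective (hginj.comp (Tuple.sort g).injective)
    have h3 := (h1.range_inj h2).1
      (by rw [τ.surjective.range_comp, (Tuple.sort g).surjective.range_comp])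
    exact Equiv.ext fun i => hginj (congrFun h3 i)

theorem measurePreserving_perm {n : ℕ} (σ : Equiv.Perm (Fin n)) :
    MeasurePreserving (fun x : Fin n → ℂ => x ∘ σ) volume volume := by
  have := volume_measurePreserving_piCongrLeft (fun _ : Fin n => ℂ) σ.symm
  convert this using 1
  ext x i
  have := MeasurableEquiv.piCongrLeft_apply_apply (β := fun _ : Fin n => ℂ) (e := σ.symm) x (σ i)
  simpa using this.symm

/-- The squared modulus of the Vandermonde determinant, as a density. -/
noncomputable def density {n : ℕ} (x : Fin n → ℂ) : ℝ≥0∞ :=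
  ENNReal.ofReal (‖(vandermonde x).det‖ ^ 2)

theorem continuous_vandermonde_det (n : ℕ) :
    Continuous fun x : Fin n → ℂ => (vandermonde x).det := by
  simp only [det_vandermonde]
  fun_prop

theorem measurable_density (n : ℕ) : Measurable (density : (Fin n → ℂ) → ℝ≥0∞) :=
  ((continuous_vandermonde_det n).norm.pow 2).measurable.ennreal_ofReal

theorem vandermonde_det_perm {n : ℕ} (x : Fin n → ℂ) (σ : Equiv.Perm (Fin n)) :
    (vandermonde (x ∘ σ)).det = ((Equiv.Perm.sign σ : ℤ) : ℂ) * (vandermonde x).det := by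
  rw [← det_permute σ (vandermonde x)]
  rfl

theorem density_perm {n : ℕ} (x : Fin n → ℂ) (σ : Equiv.Perm (Fin n)) :
    density (x ∘ σ) = density x := by
  rw [density, density, vandermonde_det_perm, norm_mul]
  rcases Int.units_eq_one_or (Equiv.Perm.sign σ) with h | h <;> simp [h]

/-- The real determinant of a complex linear map is the squared modulus of its complex determinant,
and the sign ε has modulus 1. -/
theorem abs_det_restrictScalars {n : ℕ} {x : Fin n → ℂ} (hx : x ∉ coincidenceSet n) :
    ENNReal.ofReal |((fderiv ℂ (symmetrization n) x).restrictScalars ℝ).det| = density x := by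
  obtain ⟨ε, hε, hJ⟩ := exists_jacobianDet_eq n
  have h : ((fderiv ℂ (symmetrization n) x).restrictScalars ℝ).det =
      Algebra.norm ℝ (jacobianDet n x) := LinearMap.det_restrictScalars
  have hn : ‖ε‖ = 1 := by
    have := congrArg norm hε
    rw [norm_mul, norm_one] at this
    nlinarith [norm_nonneg ε]
  rw [h, Algebra.norm_complex_apply, Complex.normSq_eq_norm_sq, hJ x hx, norm_mul, hn, one_mul,
    density, abs_of_nonneg (by positivity)]

theorem map_restrict_chamber (n : ℕ) :
    Measure.map (symmetrization n) ((volume.restrict (chamber n)).withDensity density) =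
      volume.restrict (symmetrization n '' chamber n) := by
  have hm := (continuous_symmetrization n).measurable
  ext S hS
  have hC := (hm hS).inter (measurableSet_chamber n)
  rw [Measure.map_apply hm hS, withDensity_apply _ (hm hS), Measure.restrict_restrict (hm hS),
    Measure.restrict_apply hS, Set.inter_comm S, ← Set.image_inter_preimage, Set.inter_comm (chamber n),
    ← lintegral_abs_det_fderiv_eq_addHaar_image volume hC
      (fun x _ => (((differentiable_symmetrization n) x).hasFDerivAt.restrictScalars
        ℝ).hasFDerivWithinAt)
      ((injOn_symmetrization_chamber n).mono Set.inter_subset_right)]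
  exact setLIntegral_congr_fun hC fun x hx =>
    (abs_det_restrictScalars (not_mem_coincidenceSet_of_mem_chamber hx.2)).symm

/-- Sorting coordinates reaches every point except the image of the coincidence set, which is null
as a differentiable image of a null set. -/
theorem image_chamber_ae_eq (n : ℕ) :
    (symmetrization n '' chamber n : Set _) =ᵐ[volume] symmetrizedPolydisc n := by
  refine Filter.EventuallyLE.antisymm
    (Filter.Eventually.of_forall (Set.image_mono (chamber_subset_polydisc n))) ?_
  have h0 : volume (symmetrization n '' coincidenceSet n) = 0 :=
    addHaar_image_eq_zero_of_differentiableOn_of_addHaar_eq_zero volume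
      ((differentiable_symmetrization n).restrictScalars ℝ).differentiableOn
      (volume_coincidenceSet n)
  filter_upwards [measure_eq_zero_iff_ae_notMem.1 h0] with z hz
  rintro ⟨x, hx, rfl⟩
  have hxc : x ∉ coincidenceSet n := fun h => hz ⟨x, h, rfl⟩
  obtain ⟨σ, hσ, -⟩ := existsUnique_perm_mem_chamber hx hxc
  exact ⟨x ∘ σ, hσ, symmetrization_perm x σ⟩

/-- Permuted copies of the chamber tile the polydisc up to a null set, and both volume and density
are permutation invariant. -/
theorem withDensity_polydisc_eq_sum (n : ℕ) :
    (volume.restrict (polydisc n)).withDensity density =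
      ∑ σ : Equiv.Perm (Fin n), Measure.map (fun x : Fin n → ℂ => x ∘ σ)
        ((volume.restrict (chamber n)).withDensity density) := by
  ext S hS
  rw [Measure.finsetSum_apply, withDensity_apply _ hS, Measure.restrict_restrict hS]
  have hterm : ∀ σ : Equiv.Perm (Fin n), Measure.map (fun x : Fin n → ℂ => x ∘ σ)
      ((volume.restrict (chamber n)).withDensity density) S =
      ∫⁻ x, (S ∩ {x | x ∘ σ.symm ∈ chamber n}).indicator density x := fun σ => by
    have hσ := measurePreserving_perm (n := n) σ
    have hσ' := (measurePreserving_perm (n := n) σ.symm).measurable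
    have hm : MeasurableSet (S ∩ {x | x ∘ σ.symm ∈ chamber n}) :=
      hS.inter (hσ' (measurableSet_chamber n))
    rw [Measure.map_apply hσ.measurable hS, withDensity_apply _ (hσ.measurable hS),
      Measure.restrict_restrict (hσ.measurable hS), ← lintegral_indicator
        ((hσ.measurable hS).inter (measurableSet_chamber n)),
      ← hσ.lintegral_comp ((measurable_density n).indicator hm)]
    refine lintegral_congr fun x => ?_
    have hx : (x ∘ σ) ∘ σ.symm = x := by ext i; simp
    have hmem : x ∘ σ ∈ S ∩ {x | x ∘ σ.symm ∈ chamber n} ↔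
        x ∈ (fun x => x ∘ σ) ⁻¹' S ∩ chamber n := by
      rw [Set.mem_inter_iff, Set.mem_ofPred_eq, hx]
      rfl
    by_cases h : x ∈ (fun x => x ∘ σ) ⁻¹' S ∩ chamber n
    · rw [Set.indicator_of_mem h, Set.indicator_of_mem (hmem.2 h), density_perm]
    · rw [Set.indicator_of_notMem h, Set.indicator_of_notMem (mt hmem.1 h)]
  rw [Finset.sum_congr rfl fun σ _ => hterm σ, ← lintegral_finsetSum]
  · rw [← lintegral_indicator (hS.inter (isOpen_polydisc n).measurableSet)]
    refine lintegral_congr_ae ?_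
    filter_upwards [measure_eq_zero_iff_ae_notMem.1 (volume_coincidenceSet n)] with x hx
    by_cases hxS : x ∈ S ∩ polydisc n
    · obtain ⟨σ, hσ, hu⟩ := existsUnique_perm_mem_chamber hxS.2 hx
      -- The inverse appears because the term of σ lives on the points x with `x ∘ σ.symm` in the
      -- chamber.
      rw [Set.indicator_of_mem hxS, Finset.sum_eq_single σ.symm]
      · rw [Set.indicator_of_mem]
        exact ⟨hxS.1, by simpa using hσ⟩
      · intro τ _ hτ
        refine Set.indicator_of_notMem (fun h => hτ ?_) _
        rw [← hu τ.symm h.2, Equiv.symm_symm]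
      · simp
    · rw [Set.indicator_of_notMem hxS, Finset.sum_eq_zero]
      intro σ _
      refine Set.indicator_of_notMem (fun h => hxS ⟨h.1, ?_⟩) _
      exact (perm_mem_polydisc σ.symm).1 (chamber_subset_polydisc n h.2)
  · intro σ _
    exact (measurable_density n).indicator
      (hS.inter ((measurePreserving_perm σ.symm).measurable (measurableSet_chamber n)))

/-- Change of variables for the symmetrization map of the polydisc. -/
theorem map_withDensity_polydisc (n : ℕ) :
    Measure.map (symmetrization n) ((volume.restrict (polydisc n)).withDensity density) =
      (n.factorial : ℝ≥0∞) • volume.restrict (symmetrizedPolydisc n) := by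
  have hm := (continuous_symmetrization n).measurable
  have h : ∀ σ : Equiv.Perm (Fin n), symmetrization n ∘ (fun x : Fin n → ℂ => x ∘ σ) =
      symmetrization n := fun σ => funext fun x => symmetrization_perm x σ
  rw [withDensity_polydisc_eq_sum, ← Measure.mapₗ_apply_of_measurable hm, map_sum]
  simp only [Measure.mapₗ_apply_of_measurable hm,
    Measure.map_map hm (measurePreserving_perm _).measurable, h, map_restrict_chamber,
    Measure.restrict_congr_set (image_chamber_ae_eq n)]
  rw [Finset.sum_const, Finset.card_univ, Fintype.card_perm, Fintype.card_fin,
    Nat.cast_smul_eq_nsmul]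

end SymmetrizedPolydisc

/-! ### The reproducing property on the symmetrized polydisc. -/

namespace SymmetrizedPolydisc

open Matrix Topology
open scoped ENNReal

/-- The image of the chamber is Borel, being an injective continuous image of a Borel set; working
on it avoids showing that 𝔾_n is measurable. -/
theorem restrict_symmetrizedPolydisc (n : ℕ) : volume.restrict (symmetrizedPolydisc n) =
    volume.restrict (symmetrization n '' chamber n) :=
  (Measure.restrict_congr_set (image_chamber_ae_eq n)).symm

theorem measurableSet_image_chamber (n : ℕ) : MeasurableSet (symmetrization n '' chamber n) :=
  (measurableSet_chamber n).image_of_continuousOn_injOn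
    (continuous_symmetrization n).continuousOn (injOn_symmetrization_chamber n)

theorem image_chamber_subset (n : ℕ) :
    symmetrization n '' chamber n ⊆ symmetrizedPolydisc n :=
  Set.image_mono (chamber_subset_polydisc n)

theorem ae_restrict_symmetrizedPolydisc {n : ℕ} {p : (Fin n → ℂ) → Prop}
    (h : ∀ x ∈ polydisc n, p (symmetrization n x)) :
    ∀ᵐ z ∂volume.restrict (symmetrizedPolydisc n), p z := by
  rw [restrict_symmetrizedPolydisc, ae_restrict_iff' (measurableSet_image_chamber n)]
  refine Filter.Eventually.of_forall ?_
  rintro _ ⟨x, hx, rfl⟩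
  exact h x hx.1

theorem aestronglyMeasurable_symmetrizedPolydisc {n : ℕ} {f : (Fin n → ℂ) → ℂ}
    (hf : ContinuousOn f (symmetrizedPolydisc n)) :
    AEStronglyMeasurable f (volume.restrict (symmetrizedPolydisc n)) := by
  rw [restrict_symmetrizedPolydisc]
  exact (hf.mono (image_chamber_subset n)).aestronglyMeasurable (measurableSet_image_chamber n)

instance isFiniteMeasure_restrict_symmetrizedPolydisc (n : ℕ) :
    IsFiniteMeasure (volume.restrict (symmetrizedPolydisc n)) := by
  refine ⟨?_⟩
  rw [Measure.restrict_apply_univ]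
  refine lt_of_le_of_lt (measure_mono (Set.image_mono fun x hx j => (hx j).le))
    ((isCompact_closedPolydisc n 1).image (continuous_symmetrization n)).measure_lt_top

theorem integral_symmetrizedPolydisc {n : ℕ} {h : (Fin n → ℂ) → ℂ}
    (hh : AEStronglyMeasurable h (volume.restrict (symmetrizedPolydisc n))) :
    (n.factorial : ℂ) * ∫ z in symmetrizedPolydisc n, h z =
      ∫ x in polydisc n, ((‖(vandermonde x).det‖ ^ 2 : ℝ) : ℂ) * h (symmetrization n x) := by
  have hmap := map_withDensity_polydisc n
  have h1 : (n.factorial : ℂ) * ∫ z in symmetrizedPolydisc n, h z =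
      ∫ z, h z ∂((n.factorial : ℝ≥0∞) • volume.restrict (symmetrizedPolydisc n)) := by
    rw [integral_smul_measure]
    simp
  rw [h1, ← hmap, integral_map (continuous_symmetrization n).aemeasurable,
    integral_withDensity_eq_integral_toReal_smul (measurable_density n)
      (Filter.Eventually.of_forall fun x => ENNReal.ofReal_lt_top)]
  · refine integral_congr_ae (Filter.Eventually.of_forall fun x => ?_)
    simp only [density]
    rw [ENNReal.toReal_ofReal (by positivity), Complex.real_smul]
  · rw [hmap]
    exact hh.smul_measure _

/-- The pullback of a function on the symmetrized polydisc to an antisymmetric function. -/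
noncomputable def pullback {n : ℕ} (f : (Fin n → ℂ) → ℂ) (x : Fin n → ℂ) : ℂ :=
  f (symmetrization n x) * (vandermonde x).det

theorem differentiable_vandermonde_det (n : ℕ) :
    Differentiable ℂ fun x : Fin n → ℂ => (vandermonde x).det := by
  simp only [det_vandermonde]
  fun_prop

theorem differentiableOn_pullback {n : ℕ} {f : (Fin n → ℂ) → ℂ}
    (hf : DifferentiableOn ℂ f (symmetrizedPolydisc n)) :
    DifferentiableOn ℂ (pullback f) (polydisc n) :=
  (hf.comp (differentiable_symmetrization n).differentiableOn fun x hx => ⟨x, hx, rfl⟩).mul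
    (differentiable_vandermonde_det n).differentiableOn

/-- The density |V|² turns |f ∘ π_n|² into the squared modulus of the pullback, which is thus in L²,
hence in L¹ on a set of finite measure. -/
theorem integrableOn_pullback {n : ℕ} {f : (Fin n → ℂ) → ℂ}
    (hf : f ∈ bergmanSpace (symmetrizedPolydisc n)) : IntegrableOn (pullback f) (polydisc n) := by
  have : IsFiniteMeasure (volume.restrict (polydisc n)) :=
    ⟨by rw [Measure.restrict_apply_univ]; exact volume_polydisc_lt_top n⟩
  have h1 := hf.2.smul_measure (c := (n.factorial : ℝ≥0∞)) (ENNReal.natCast_ne_top _)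
  rw [← map_withDensity_polydisc n] at h1
  have h2 := h1.comp_of_map (continuous_symmetrization n).aemeasurable
  have h3 := (memLp_two_iff_integrable_sq_norm h2.1).1 h2
  rw [integrable_withDensity_iff_integrable_smul' (measurable_density n)
    (Filter.Eventually.of_forall fun x => ENNReal.ofReal_lt_top)] at h3
  have hmeas : AEStronglyMeasurable (pullback f) (volume.restrict (polydisc n)) :=
    (differentiableOn_pullback hf.1).continuousOn.aestronglyMeasurable
      (isOpen_polydisc n).measurableSet
  have h4 : MemLp (pullback f) 2 (volume.restrict (polydisc n)) := by
    rw [memLp_two_iff_integrable_sq_norm hmeas]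
    refine h3.congr (Filter.Eventually.of_forall fun x => ?_)
    simp only [density, pullback, Function.comp]
    rw [ENNReal.toReal_ofReal (by positivity), norm_mul, smul_eq_mul]
    ring
  exact h4.integrable one_le_two

theorem sum_sign_mul_prodKernel {n : ℕ} (x y : Fin n → ℂ) :
    ∑ σ : Equiv.Perm (Fin n), ((Equiv.Perm.sign σ : ℤ) : ℂ) * prodKernel x (y ∘ σ) =
      starRingEnd ℂ (Matrix.of fun j k => 1 / (1 - x j * starRingEnd ℂ (y k)) ^ 2).det := by
  rw [← det_transpose, det_apply']
  simp [prodKernel, map_sum, map_prod]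

theorem exists_bound_explicitKernel {n : ℕ} [NeZero n] {r : ℝ} (hr : r < 1) :
    ∃ M, ∀ x ∈ polydisc n, ∀ y : Fin n → ℂ, (∀ j, ‖y j‖ ≤ r) →
      ‖explicitKernel n (symmetrization n x) (symmetrization n y)‖ ≤ M := by
  obtain ⟨M, hM⟩ := ((isCompact_closedPolydisc n 1).prod
    (isCompact_closedPolydisc n r)).exists_bound_of_continuousOn
    ((continuousOn_explicitKernel n).mono
      (Set.prod_mono le_rfl fun y hy j => (hy j).trans_lt hr))
  exact ⟨M, fun x hx y hy => hM (x, y) ⟨fun j => (hx j).le, hy⟩⟩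

theorem norm_lt_one_of_mem_polydisc {n : ℕ} {y : Fin n → ℂ} (hy : y ∈ polydisc n) : ‖y‖ < 1 :=
  (pi_norm_lt_iff zero_lt_one).2 hy

theorem explicitKernel_mem_bergmanSpace {n : ℕ} [NeZero n] {w : Fin n → ℂ}
    (hw : w ∈ symmetrizedPolydisc n) :
    (fun z => explicitKernel n z w) ∈ bergmanSpace (symmetrizedPolydisc n) := by
  have hd := differentiableOn_explicitKernel hw
  obtain ⟨y, hy, rfl⟩ := hw
  obtain ⟨M, hM⟩ := exists_bound_explicitKernel (n := n) (norm_lt_one_of_mem_polydisc hy)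
  exact ⟨hd, MemLp.of_bound (aestronglyMeasurable_symmetrizedPolydisc hd.continuousOn) M
    (ae_restrict_symmetrizedPolydisc fun x hx => hM x hx y (norm_le_pi_norm y))⟩

theorem aestronglyMeasurable_mul_conj_explicitKernel {n : ℕ} [NeZero n] {f : (Fin n → ℂ) → ℂ}
    (hf : f ∈ bergmanSpace (symmetrizedPolydisc n)) {w : Fin n → ℂ}
    (hw : w ∈ symmetrizedPolydisc n) :
    AEStronglyMeasurable (fun z => f z * starRingEnd ℂ (explicitKernel n z w))
      (volume.restrict (symmetrizedPolydisc n)) :=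
  hf.2.1.mul (Complex.continuous_conj.comp_aestronglyMeasurable
    (explicitKernel_mem_bergmanSpace hw).2.1)

/-- The polydisc formula is applied at every permutation of y. Antisymmetry of the pullback cancels
the signs, so all n! terms agree; the factor V(y) can be divided out because y has distinct
coordinates. -/
theorem reproducing_of_notMem_coincidenceSet {n : ℕ} [NeZero n] {f : (Fin n → ℂ) → ℂ}
    (hf : f ∈ bergmanSpace (symmetrizedPolydisc n)) {y : Fin n → ℂ} (hy : y ∈ polydisc n)
    (hyc : y ∉ coincidenceSet n) :
    f (symmetrization n y) = ∫ z in symmetrizedPolydisc n,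
      f z * starRingEnd ℂ (explicitKernel n z (symmetrization n y)) := by
  have hF := differentiableOn_pullback hf.1
  have hFi := integrableOn_pullback hf
  have hrep : ∀ σ : Equiv.Perm (Fin n),
      ∫ x in polydisc n, pullback f x * (((Equiv.Perm.sign σ : ℤ) : ℂ) * prodKernel x (y ∘ σ)) =
        Real.pi ^ n * pullback f y := fun σ => by
    have h := polydisc_reproducing hF hFi ((perm_mem_polydisc σ).2 hy)
    have hpb : pullback f (y ∘ σ) = ((Equiv.Perm.sign σ : ℤ) : ℂ) * pullback f y := by
      rw [pullback, symmetrization_perm, vandermonde_det_perm, pullback]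
      ring
    calc _ = ((Equiv.Perm.sign σ : ℤ) : ℂ) *
          ∫ x in polydisc n, pullback f x * prodKernel x (y ∘ σ) := by
          rw [← integral_const_mul]
          refine integral_congr_ae (Filter.Eventually.of_forall fun x => ?_)
          ring
      _ = _ := by
          rw [h, hpb]
          linear_combination (Real.pi : ℂ) ^ n * pullback f y * sign_cast_mul_self σ
  have hint : ∀ σ : Equiv.Perm (Fin n), IntegrableOn
      (fun x => pullback f x * (((Equiv.Perm.sign σ : ℤ) : ℂ) * prodKernel x (y ∘ σ)))
      (polydisc n) := fun σ => by
    have hσ := (perm_mem_polydisc σ).2 hy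
    obtain ⟨C, -, hC⟩ := exists_bound_prodKernel hσ
    refine Integrable.mul_bdd (c := C) hFi ?_ ?_
    · exact ((continuousOn_prodKernel hσ).aestronglyMeasurable
        (isOpen_polydisc n).measurableSet).const_mul _
    · refine (ae_restrict_iff' (isOpen_polydisc n).measurableSet).2
        (Filter.Eventually.of_forall fun x hx => ?_)
      rw [norm_mul]
      rcases Int.units_eq_one_or (Equiv.Perm.sign σ) with h | h <;> simpa [h] using hC x hx
  have hsum : ∑ σ : Equiv.Perm (Fin n), ∫ x in polydisc n,
      pullback f x * (((Equiv.Perm.sign σ : ℤ) : ℂ) * prodKernel x (y ∘ σ)) =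
      (n.factorial : ℂ) * (Real.pi ^ n * pullback f y) := by
    rw [Finset.sum_congr rfl fun σ _ => hrep σ, Finset.sum_const, Finset.card_univ,
      Fintype.card_perm, Fintype.card_fin, nsmul_eq_mul]
  rw [← integral_finsetSum _ fun σ _ => hint σ] at hsum
  -- Of |V(x)|² = V(x) conj V(x), the first factor enters the pullback; the second, with πⁿ V(y),
  -- clears the denominator of the conjugated kernel.
  have hkey : ∫ x in polydisc n, ∑ σ : Equiv.Perm (Fin n),
      pullback f x * (((Equiv.Perm.sign σ : ℤ) : ℂ) * prodKernel x (y ∘ σ)) =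
      Real.pi ^ n * (vandermonde y).det * ((n.factorial : ℂ) * ∫ z in symmetrizedPolydisc n,
        f z * starRingEnd ℂ (explicitKernel n z (symmetrization n y))) := by
    rw [integral_symmetrizedPolydisc
      (aestronglyMeasurable_mul_conj_explicitKernel hf ⟨y, hy, rfl⟩), ← integral_const_mul]
    refine setIntegral_congr_fun (isOpen_polydisc n).measurableSet fun x hx => ?_
    rw [← Finset.mul_sum, sum_sign_mul_prodKernel,
      ← explicitKernel_mul_vandermonde (fun j => (hx j).le) hy, ← Complex.normSq_eq_norm_sq,
      ← Complex.mul_conj, pullback]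
    simp only [map_mul, map_pow, Complex.conj_ofReal, Complex.conj_conj]
    ring
  rw [hkey] at hsum
  have h1 : (Real.pi : ℂ) ^ n ≠ 0 := pow_ne_zero n (by exact_mod_cast Real.pi_ne_zero)
  have h2 : (n.factorial : ℂ) ≠ 0 := by exact_mod_cast n.factorial_ne_zero
  have h3 := det_vandermonde_ne_zero hyc
  rw [pullback] at hsum
  apply mul_left_cancel₀ (mul_ne_zero (mul_ne_zero h1 h2) h3)
  linear_combination -hsum

/-- Dominated convergence: near y the kernel is bounded uniformly in z, and f is integrable since
𝔾_n has finite measure. -/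
theorem continuousOn_integral_explicitKernel {n : ℕ} [NeZero n] {f : (Fin n → ℂ) → ℂ}
    (hf : f ∈ bergmanSpace (symmetrizedPolydisc n)) :
    ContinuousOn (fun y => ∫ z in symmetrizedPolydisc n,
      f z * starRingEnd ℂ (explicitKernel n z (symmetrization n y))) (polydisc n) := by
  intro y hy
  apply ContinuousAt.continuousWithinAt
  have hy1 := norm_lt_one_of_mem_polydisc hy
  obtain ⟨r, hyr, hr⟩ := exists_between hy1
  obtain ⟨M, hM⟩ := exists_bound_explicitKernel (n := n) hr
  have hnhds : ∀ᶠ u in 𝓝 y, ‖u‖ < r := continuous_norm.continuousAt.eventually_lt_const hyr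
  have hmem : ∀ᶠ u in 𝓝 y, u ∈ polydisc n := (isOpen_polydisc n).mem_nhds hy
  refine continuousAt_of_dominated (bound := fun z => ‖f z‖ * M) ?_ ?_ ?_ ?_
  · filter_upwards [hmem] with u hu
    exact aestronglyMeasurable_mul_conj_explicitKernel hf ⟨u, hu, rfl⟩
  · filter_upwards [hnhds] with u hu
    refine ae_restrict_symmetrizedPolydisc fun x hx => ?_
    rw [norm_mul, RCLike.norm_conj]
    exact mul_le_mul_of_nonneg_left (hM x hx u fun j => (norm_le_pi_norm u j).trans hu.le)
      (norm_nonneg _)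
  · exact (hf.2.integrable one_le_two).norm.mul_const M
  · refine ae_restrict_symmetrizedPolydisc fun x hx => ?_
    have hc : ContinuousOn
        (fun u => explicitKernel n (symmetrization n x) (symmetrization n u)) (polydisc n) :=
      (continuousOn_explicitKernel n).comp (f := fun u => (x, u)) (by fun_prop)
        fun u hu => ⟨fun j => (hx j).le, hu⟩
    exact continuousAt_const.mul (Complex.continuous_conj.continuousAt.comp
      (hc.continuousAt ((isOpen_polydisc n).mem_nhds hy)))

theorem isBergmanKernel_explicitKernel (n : ℕ) [NeZero n] :
    IsBergmanKernel (symmetrizedPolydisc n) (explicitKernel n) := by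
  refine ⟨fun w hw => explicitKernel_mem_bergmanSpace hw, ?_⟩
  rintro f hf _ ⟨y, hy, rfl⟩
  have hc : ContinuousOn (fun y => f (symmetrization n y)) (polydisc n) :=
    hf.1.continuousOn.comp (continuous_symmetrization n).continuousOn fun x hx => ⟨x, hx, rfl⟩
  have hdense : polydisc n ⊆ closure (polydisc n ∩ (coincidenceSet n)ᶜ) :=
    (dense_compl_coincidenceSet n).open_subset_closure_inter (isOpen_polydisc n)
  exact Set.EqOn.of_subset_closure (s := polydisc n ∩ (coincidenceSet n)ᶜ)
    (fun u hu => reproducing_of_notMem_coincidenceSet hf hu.1 hu.2) hc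
    (continuousOn_integral_explicitKernel hf) Set.inter_subset_left hdense hy

theorem IsBergmanKernel.bergmanKernel {n : ℕ} {D : Set (Fin n → ℂ)}
    {K : (Fin n → ℂ) → (Fin n → ℂ) → ℂ} (h : IsBergmanKernel D K) :
    IsBergmanKernel D (bergmanKernel D) := by
  have hex : ∃ K, IsBergmanKernel D K := ⟨K, h⟩
  rw [SymmetrizedPolydisc.bergmanKernel, dif_pos hex]
  exact hex.choose_spec

end SymmetrizedPolydisc

/-! ### The kernel formula. -/

open SymmetrizedPolydisc
theorem proposition9 (n : ℕ) (hn : 1 ≤ n) :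
    IsBergmanKernel (symmetrizedPolydisc n) (bergmanKernel (symmetrizedPolydisc n)) ∧
    ∀ x ∈ polydisc n \ coincidenceSet n, ∀ y ∈ polydisc n \ coincidenceSet n,
      jacobianDet n x ≠ 0 ∧ jacobianDet n y ≠ 0 ∧
      bergmanKernel (symmetrizedPolydisc n) (symmetrization n x) (symmetrization n y) =
        (Matrix.of fun j k : Fin n => 1 / (1 - x j * starRingEnd ℂ (y k)) ^ 2).det /
          ((Real.pi : ℂ) ^ n * jacobianDet n x * starRingEnd ℂ (jacobianDet n y)) := by
  have : NeZero n := ⟨by omega⟩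
  have hK := isBergmanKernel_explicitKernel n
  refine ⟨hK.bergmanKernel, fun x hx y hy => ?_⟩
  obtain ⟨ε, hε, hJ⟩ := exists_jacobianDet_eq n
  have hε0 : ε ≠ 0 := left_ne_zero_of_mul (hε.trans_ne one_ne_zero)
  -- Since ε = ±1 is real, the signs of the two Jacobians multiply to ε² = 1 and drop out.
  have hεc : starRingEnd ℂ ε = ε := by
    rcases mul_self_eq_one_iff.1 hε with h | h <;> simp [h]
  have hx0 := det_vandermonde_ne_zero hx.2
  have hy0 := det_vandermonde_ne_zero hy.2
  have hyc0 : starRingEnd ℂ (Matrix.vandermonde y).det ≠ 0 := (map_ne_zero _).2 hy0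
  have hpi : (Real.pi : ℂ) ^ n ≠ 0 := pow_ne_zero n (by exact_mod_cast Real.pi_ne_zero)
  rw [hJ x hx.2, hJ y hy.2]
  refine ⟨mul_ne_zero hε0 hx0, mul_ne_zero hε0 hy0, ?_⟩
  rw [hK.bergmanKernel.unique hK ⟨x, hx.1, rfl⟩ ⟨y, hy.1, rfl⟩,
    ← explicitKernel_mul_vandermonde (fun j => (hx.1 j).le) hy.1, map_mul, hεc, eq_div_iff
      (mul_ne_zero (mul_ne_zero hpi (mul_ne_zero hε0 hx0)) (mul_ne_zero hε0 hyc0))]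
  linear_combination explicitKernel n (symmetrization n x) (symmetrization n y) *
    (Real.pi : ℂ) ^ n * (Matrix.vandermonde x).det *
    starRingEnd ℂ (Matrix.vandermonde y).det * hε
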